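/- Let $M$ be a square integrable Lévy process with values in $\mathbb R^m$ and mean zero, and let $\mathcal Q_M=\mathbb E[M(1)M(1)^T]$. Let $A\in\mathbb R^{n\times n}$ be asymptotically stable ($\sigma(A)\subset\mathbb C_-$), $B\in\mathbb R^{n\times m}$, $C\in\mathbb R^{p\times n}$, and consider $$dx(t)=Ax(t)\,dt+B\,dM(t),\qquad x(0)=0,\qquad y(t)=Cx(t),\qquad t\ge 0.$$ Assume that the Gramians $$P=\int_0^\infty e^{As}B\mathcal Q_MB^Te^{A^Ts}\,ds,\qquad Q=\int_0^\infty e^{A^Ts}C^TCe^{As}\,ds$$ are positive definite. Let $\sigma_1\ge\dots\ge\sigma_n$ be the Hankel singular values, i.e. the square roots of the eigenvalues of $PQ$ counted with multiplicity, let $1\le r<n$, and assume $\sigma_r\ne\sigma_{r+1}$. Let $T\in\mathbb R^{n\times n}$ be a balancing transformation, i.e. $T$ is nonsingular and $TPT^T=T^{-T}QT^{-1}=\operatorname{diag}(\sigma_1,\dots,\sigma_n)$. Put $\Sigma_2=\operatorname{diag}(\sigma_{r+1},\dots,\sigma_n)$ and partition $$TAT^{-1}=\begin{pmatrix}A_{11}&A_{12}\\A_{21}&A_{22}\end{pmatrix},\qquad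 TB=\begin{pmatrix}B_1\\B_2\end{pmatrix},\qquad CT^{-1}=\begin{pmatrix}C_1&C_2\end{pmatrix},$$ with $A_{11}\in\mathbb R^{r\times r}$, $B_1\in\mathbb R^{r\times m}$, $C_1\in\mathbb R^{p\times r}$. Then $A_{22}$ is invertible. Let $$A_r=A_{11}-A_{12}A_{22}^{-1}A_{21},\qquad B_r=B_1,\qquad C_r=C_1-C_2A_{22}^{-1}A_{21},$$ and let $y_{SPA}=C_rx_r$ be the output of the reduced order model obtained by singular perturbation approximation, $$dx_r(t)=A_rx_r(t)\,dt+B_r\,dM(t),\qquad x_r(0)=0.$$ Then the integral $P_g=\int_0^\infty e^{As}B\mathcal Q_MB_r^Te^{A_r^Ts}\,ds$ converges absolutely, and, if $P_{g,1}$ denotes the first $r$ and $P_{g,2}$ the last $n-r$ rows of $TP_g$, for every time horizon $\tau\ge 0$ $$\sup_{t\in[0,\tau]}\mathbb E\,\|y(t)-y_{SPA}(t)\|_{\mathbb R^p}\le\Bigl(\operatorname{tr}\bigl(\Sigma_2\bigl(B_2\mathcal Q_MB_2^T-2(A_{22}P_{g,2}+A_{21}P_{g,1})(A_{22}^{-1}A_{21})^T\bigr)\bigr)\Bigr)^{1/2},$$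 where the trace is nonnegative and $y(t)-y_{SPA}(t)$ is integrable for every $t\in[0,\tau]$. -/

import Mathlib

open MeasureTheory ProbabilityTheory Filter Topology
open scoped NNReal Matrix

/-! ### Lévy processes -/

/-- Right-continuous paths with left limits on `[0, ∞)`. -/
def IsCadlagPath {E : Type*} [TopologicalSpace E] (f : ℝ≥0 → E) : Prop :=
  ∀ t, ContinuousWithinAt f (Set.Ioi t) t ∧ ∃ l, Tendsto f (𝓝[<] t) (𝓝 l)

/-- `ℝᵐ`-valued Lévy processes. -/
structure IsLevyProcess {Ω : Type*} [MeasurableSpace Ω] {m : ℕ}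
    (M : ℝ≥0 → Ω → (Fin m → ℝ)) (μ : Measure Ω) : Prop where
  measurable : ∀ t, Measurable (M t)
  start_zero : ∀ᵐ ω ∂μ, M 0 ω = 0
  indep_increments : HasIndepIncrements M μ
  stationary_increments : ∀ s h : ℝ≥0,
    IdentDistrib (fun ω => M (s + h) ω - M s ω) (M h) μ μ
  stochastically_continuous : ∀ t : ℝ≥0, TendstoInMeasure μ M (𝓝 t) (M t)
  cadlag : ∀ᵐ ω ∂μ, IsCadlagPath (fun t => M t ω)

/-- The matrix `E[M(1) M(1)ᵀ]`. -/
noncomputable def covMatrix {Ω : Type*} [MeasurableSpace Ω] {m : ℕ}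
    (M : ℝ≥0 → Ω → (Fin m → ℝ)) (μ : Measure Ω) : Matrix (Fin m) (Fin m) ℝ :=
  Matrix.of fun i j => ∫ ω, M 1 ω i * M 1 ω j ∂μ

/-! ### Linear systems driven by additive noise -/

/-- The coefficients of `dx = A x dt + B dM`, `y = C x`, with `n` states, `m` noise components
and `p` outputs. -/
structure LinSys (n m p : ℕ) where
  A : Matrix (Fin n) (Fin n) ℝ
  B : Matrix (Fin n) (Fin m) ℝ
  C : Matrix (Fin p) (Fin n) ℝ

/-- The complex spectrum lies in the open left half plane. -/
def IsAsymptoticallyStable {n : ℕ} (A : Matrix (Fin n) (Fin n) ℝ) : Prop :=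
  ∀ z ∈ spectrum ℂ (A.map (algebraMap ℝ ℂ)), z.re < 0

/-- The integrand `exp(A₁ s) K exp(A₂ᵀ s)` of the Gramians. -/
noncomputable def gramianIntegrand {n₁ n₂ : ℕ} (A₁ : Matrix (Fin n₁) (Fin n₁) ℝ)
    (K : Matrix (Fin n₁) (Fin n₂) ℝ) (A₂ : Matrix (Fin n₂) (Fin n₂) ℝ) (s : ℝ) :
    Matrix (Fin n₁) (Fin n₂) ℝ :=
  NormedSpace.exp (s • A₁) * K * NormedSpace.exp (s • A₂ᵀ)

/-- `∫₀^∞ exp(A₁ s) K exp(A₂ᵀ s) ds`, entry by entry. -/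
noncomputable def gramianIntegral {n₁ n₂ : ℕ} (A₁ : Matrix (Fin n₁) (Fin n₁) ℝ)
    (K : Matrix (Fin n₁) (Fin n₂) ℝ) (A₂ : Matrix (Fin n₂) (Fin n₂) ℝ) :
    Matrix (Fin n₁) (Fin n₂) ℝ :=
  Matrix.of fun i j => ∫ s in Set.Ioi (0 : ℝ), gramianIntegrand A₁ K A₂ s i j

namespace LinSys

/-- `x` solves `dx = A x dt + B dM`, `x(0) = x₀`: almost surely the path of `x` is càdlàg and
`x(t) = x₀ + ∫₀ᵗ A x(s) ds + ∫₀ᵗ B dM(s)` for all `t ≥ 0`. As `B` is constant, the stochastic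
integral is `B (M(t) - M(0))`. -/
structure IsSolution {n m p : ℕ} (S : LinSys n m p) {Ω : Type*} [MeasurableSpace Ω]
    (μ : Measure Ω) (M : ℝ≥0 → Ω → (Fin m → ℝ)) (x₀ : Fin n → ℝ)
    (x : ℝ≥0 → Ω → (Fin n → ℝ)) : Prop where
  cadlag : ∀ᵐ ω ∂μ, IsCadlagPath (fun t => x t ω)
  equation : ∀ᵐ ω ∂μ, ∀ t : ℝ≥0,
    x t ω = x₀ + (∫ s in (0 : ℝ)..t, S.A *ᵥ x s.toNNReal ω) + S.B *ᵥ (M t ω - M 0 ω)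

/-- The output `y(t) = C x(t)` belonging to the state `x`, a vector of Euclidean `ℝᵖ`. -/
noncomputable def output {n m p : ℕ} (S : LinSys n m p) {Ω : Type*}
    (x : ℝ≥0 → Ω → (Fin n → ℝ)) (t : ℝ≥0) (ω : Ω) : EuclideanSpace ℝ (Fin p) :=
  WithLp.toLp 2 (S.C *ᵥ x t ω)

/-- The reachability Gramian `P = ∫₀^∞ exp(A s) B Q_M Bᵀ exp(Aᵀ s) ds`. -/
noncomputable def reachGramian {n m p : ℕ} (S : LinSys n m p) (QM : Matrix (Fin m) (Fin m) ℝ) :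
    Matrix (Fin n) (Fin n) ℝ :=
  gramianIntegral S.A (S.B * QM * S.Bᵀ) S.A

/-- The observability Gramian `Q = ∫₀^∞ exp(Aᵀ s) Cᵀ C exp(A s) ds`. -/
noncomputable def obsGramian {n m p : ℕ} (S : LinSys n m p) : Matrix (Fin n) (Fin n) ℝ :=
  gramianIntegral S.Aᵀ (S.Cᵀ * S.C) S.Aᵀ

/-- The realisation `(T A T⁻¹, T B, C T⁻¹)`. -/
noncomputable def transform {n m p : ℕ} (S : LinSys n m p) (T : Matrix (Fin n) (Fin n) ℝ) :
    LinSys n m p where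
  A := T * S.A * T⁻¹
  B := T * S.B
  C := S.C * T⁻¹

/-! Blocks of the coefficients, the first `r` and the last `k` states being kept apart. -/

/-- Upper left block, `r × r`. -/
def A₁₁ {r k m p : ℕ} (S : LinSys (r + k) m p) : Matrix (Fin r) (Fin r) ℝ :=
  S.A.submatrix (Fin.castAdd k) (Fin.castAdd k)

/-- Upper right block, `r × k`. -/
def A₁₂ {r k m p : ℕ} (S : LinSys (r + k) m p) : Matrix (Fin r) (Fin k) ℝ :=
  S.A.submatrix (Fin.castAdd k) (Fin.natAdd r)

/-- Lower left block, `k × r`. -/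
def A₂₁ {r k m p : ℕ} (S : LinSys (r + k) m p) : Matrix (Fin k) (Fin r) ℝ :=
  S.A.submatrix (Fin.natAdd r) (Fin.castAdd k)

/-- Lower right block, `k × k`. -/
def A₂₂ {r k m p : ℕ} (S : LinSys (r + k) m p) : Matrix (Fin k) (Fin k) ℝ :=
  S.A.submatrix (Fin.natAdd r) (Fin.natAdd r)

/-- First `r` rows of `B`. -/
def B₁ {r k m p : ℕ} (S : LinSys (r + k) m p) : Matrix (Fin r) (Fin m) ℝ :=
  S.B.submatrix (Fin.castAdd k) id

/-- Last `k` rows of `B`. -/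
def B₂ {r k m p : ℕ} (S : LinSys (r + k) m p) : Matrix (Fin k) (Fin m) ℝ :=
  S.B.submatrix (Fin.natAdd r) id

/-- First `r` columns of `C`. -/
def C₁ {r k m p : ℕ} (S : LinSys (r + k) m p) : Matrix (Fin p) (Fin r) ℝ :=
  S.C.submatrix id (Fin.castAdd k)

/-- Last `k` columns of `C`. -/
def C₂ {r k m p : ℕ} (S : LinSys (r + k) m p) : Matrix (Fin p) (Fin k) ℝ :=
  S.C.submatrix id (Fin.natAdd r)

/-- The reduced order model of the (modified) singular perturbation approximation of a
partitioned system: `(A₁₁ - A₁₂ A₂₂⁻¹ A₂₁, B₁, C₁ - C₂ A₂₂⁻¹ A₂₁)`. -/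
noncomputable def spa {r k m p : ℕ} (S : LinSys (r + k) m p) : LinSys r m p where
  A := S.A₁₁ - S.A₁₂ * S.A₂₂⁻¹ * S.A₂₁
  B := S.B₁
  C := S.C₁ - S.C₂ * S.A₂₂⁻¹ * S.A₂₁

end LinSys

/-! ### Balancing -/

/-- The `i`-th Hankel singular value, `i = 1, 2, …`: the `i`-th largest of the numbers
`√λ`, where `λ` runs through the eigenvalues of `P Q` with multiplicity (and `0` for an index
out of range). -/
noncomputable def hankelSV {n : ℕ} (P Q : Matrix (Fin n) (Fin n) ℝ) (i : ℕ) : ℝ :=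
  (((P * Q).charpoly.roots.map Real.sqrt).sort (· ≥ ·)).getD (i - 1) 0

/-- `T` is nonsingular and transforms both Gramians into `Σ = diag(σ₁, …, σₙ)`. -/
structure IsBalancing {n : ℕ} (P Q T : Matrix (Fin n) (Fin n) ℝ) : Prop where
  isUnit_det : IsUnit T.det
  reach : T * P * Tᵀ = Matrix.diagonal fun i : Fin n => hankelSV P Q (i + 1)
  obs : (T⁻¹)ᵀ * Q * T⁻¹ = Matrix.diagonal fun i : Fin n => hankelSV P Q (i + 1)

/-!
The error bound is the squared `H₂` norm of the error system, and it is an exact expression for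
that norm; what is given away is `E‖e‖ ≤ (E‖e‖²)^(1/2)` and the passage from `[0, t]` to `[0, ∞)`.

*Probability.* Both states are Wiener type integrals `∫₀ᵗ exp(A (t - s)) B dM(s)` of deterministic
functions. Since `B` is constant, no stochastic integration theory is needed: on each càdlàg path,
summation by parts on a uniform grid and dominated convergence show that the Riemann–Stieltjes
sums converge to the state (`tendsto_variation_of_constants`). A mean zero, square integrable Lévy
process has `E (v ⬝ M(t))² = t (v ⬝ Q_M v)`, since the left hand side is additive and nonnegative
in `t`, and its increments are uncorrelated (`IsLevyProcess.integral_sq_sum_increments`). Fatou's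
lemma then bounds `E‖y(t) - y_r(t)‖²` by the integral of the squared impulse response of the
difference (`LinSys.integrable_and_integral_norm_le`).

*Stability.* A matrix with spectrum in the open left half plane has an exponentially decaying
exponential, because its generalized eigenspaces span (`IsAsymptoticallyStable.expDecays_exp`); so
all Gramians converge and solve Sylvester equations (`gramianIntegral_sylvester`). In balanced
coordinates both Lyapunov equations hold with the same `Σ = diag(Σ₁, Σ₂)`. An undamped eigenvector
of the reduced matrix (or a kernel vector of `A₂₂`) is annihilated by both right hand sides, so
the eigenspace is invariant under `Σ₁²` (or `Σ₂²`); as `Σ₁` and `Σ₂` have no common entry, it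
lifts to an undamped eigenvector of `A`, which does not exist
(`LinSys.isUnit_and_stable_of_balanced`).

*Algebra.* With `V = (I, -A₂₂⁻¹ A₂₁)` one has `A V = (A_r, 0)` and `C_r = C V`, so `A_r` and `C_r`
satisfy the observability equation with `Σ₁`. Traces of output Gramians can therefore be rewritten
by duality, and what remains is the expression in the bound (`LinSys.trace_error_eq`).
-/

section ExponentialDecay

open Asymptotics

/-! ### Exponential decay and Sylvester equations -/

open scoped Matrix.Norms.Operator in
theorem Matrix.hasDerivAt_exp_smul_apply {n : Type*} [Fintype n] [DecidableEq n]
    (A : Matrix n n ℝ) (t : ℝ) (i j : n) :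
    HasDerivAt (fun s : ℝ => NormedSpace.exp (s • A) i j)
      ((A * NormedSpace.exp (t • A)) i j) t := by
  have h := hasDerivAt_exp_smul_const' (𝕂 := ℝ) A t
  exact (hasDerivAt_pi.1 ((hasDerivAt_pi.1 h) i)) j

open scoped Matrix.Norms.Operator in
theorem Matrix.commute_exp_smul {n : Type*} [Fintype n] [DecidableEq n]
    (A : Matrix n n ℝ) (t : ℝ) :
    A * NormedSpace.exp (t • A) = NormedSpace.exp (t • A) * A :=
  (((Commute.refl A).smul_right t).exp_right).eq

theorem HasDerivAt.matrix_mul_apply {l m n : Type*} [Fintype m]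
    {F : ℝ → Matrix l m ℝ} {G : ℝ → Matrix m n ℝ} {F' : Matrix l m ℝ} {G' : Matrix m n ℝ} {t : ℝ}
    (hF : ∀ i j, HasDerivAt (fun s => F s i j) (F' i j) t)
    (hG : ∀ i j, HasDerivAt (fun s => G s i j) (G' i j) t) (i : l) (j : n) :
    HasDerivAt (fun s => (F s * G s) i j) ((F' * G t + F t * G') i j) t := by
  simp only [Matrix.mul_apply, Matrix.add_apply, ← Finset.sum_add_distrib]
  exact HasDerivAt.fun_sum fun k _ => (hF i k).mul (hG k j)

theorem hasDerivAt_gramianIntegrand {n₁ n₂ : ℕ} (A₁ : Matrix (Fin n₁) (Fin n₁) ℝ)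
    (K : Matrix (Fin n₁) (Fin n₂) ℝ) (A₂ : Matrix (Fin n₂) (Fin n₂) ℝ) (t : ℝ) (i j) :
    HasDerivAt (fun s => gramianIntegrand A₁ K A₂ s i j)
      ((A₁ * gramianIntegrand A₁ K A₂ t + gramianIntegrand A₁ K A₂ t * A₂ᵀ) i j) t := by
  have h1 : ∀ i j, HasDerivAt (fun s : ℝ => (NormedSpace.exp (s • A₁) * K) i j)
      ((A₁ * NormedSpace.exp (t • A₁) * K) i j) t := fun i j => by
    simpa using HasDerivAt.matrix_mul_apply (G := fun _ => K) (G' := 0)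
      (Matrix.hasDerivAt_exp_smul_apply A₁ t) (fun i j => hasDerivAt_const t (K i j)) i j
  have h2 := HasDerivAt.matrix_mul_apply h1 (Matrix.hasDerivAt_exp_smul_apply A₂ᵀ t) i j
  simp only [gramianIntegrand]
  rw [Matrix.commute_exp_smul A₂ᵀ t] at h2
  simpa only [Matrix.mul_assoc] using h2

open scoped Matrix.Norms.Operator in
/-- On a vector annihilated by a power of `N` the exponential series of `s N` terminates. -/
theorem Matrix.exp_smul_mulVec_of_pow_mulVec_eq_zero {n : Type*} [Fintype n] [DecidableEq n]
    (N : Matrix n n ℂ) (v : n → ℂ) {k : ℕ} (hk : N ^ k *ᵥ v = 0) (s : ℂ) :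
    NormedSpace.exp (s • N) *ᵥ v =
      ∑ j ∈ Finset.range k, (s ^ j * (j.factorial : ℂ)⁻¹) • (N ^ j *ᵥ v) := by
  have h := NormedSpace.exp_series_hasSum_exp' (𝕂 := ℂ) (s • N)
  have h2 : HasSum (fun j : ℕ => ((j.factorial : ℂ)⁻¹ • (s • N) ^ j) *ᵥ v)
      (NormedSpace.exp (s • N) *ᵥ v) := by
    have hc : Continuous fun M : Matrix n n ℂ => M *ᵥ v :=
      Continuous.matrix_mulVec continuous_id continuous_const
    exact h.map (AddMonoidHom.mk' (fun M : Matrix n n ℂ => M *ᵥ v)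
      fun a b => Matrix.add_mulVec a b v) hc
  have h3 : ∀ j : ℕ, ((j.factorial : ℂ)⁻¹ • (s • N) ^ j) *ᵥ v
      = (s ^ j * (j.factorial : ℂ)⁻¹) • (N ^ j *ᵥ v) := fun j => by
    rw [smul_pow, smul_smul, Matrix.smul_mulVec, mul_comm]
  simp only [h3] at h2
  refine h2.unique (hasSum_sum_of_ne_finset_zero fun j hj => ?_)
  obtain ⟨d, rfl⟩ := Nat.exists_eq_add_of_le (not_lt.1 (mt Finset.mem_range.2 hj))
  rw [add_comm k d, pow_add N, ← Matrix.mulVec_mulVec, hk, Matrix.mulVec_zero, smul_zero]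

open scoped Matrix.Norms.Operator in
theorem Matrix.exp_smul_eq_exp_smul_sub {n : Type*} [Fintype n] [DecidableEq n]
    (A : Matrix n n ℂ) (z s : ℂ) :
    NormedSpace.exp (s • A) =
      Complex.exp (s * z) • NormedSpace.exp (s • (A - z • (1 : Matrix n n ℂ))) := by
  have h : s • A = (s * z) • (1 : Matrix n n ℂ) + s • (A - z • (1 : Matrix n n ℂ)) := by
    rw [smul_sub, smul_smul]; abel
  rw [h, Matrix.exp_add_of_commute _ _ ((Commute.one_left _).smul_left _)]
  have : NormedSpace.exp ((s * z) • (1 : Matrix n n ℂ)) = Complex.exp (s * z) • 1 := by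
    rw [Matrix.smul_one_eq_diagonal, Matrix.exp_diagonal, Matrix.smul_one_eq_diagonal]
    congr 1; ext i
    rw [Pi.exp_def, Complex.exp_eq_exp_ℂ]
  rw [this, smul_mul_assoc, one_mul]

/-- Exponential decay at `+∞`, with an unspecified positive rate. -/
def ExpDecays {E : Type*} [Norm E] (f : ℝ → E) : Prop :=
  ∃ ε > 0, f =O[atTop] fun s => Real.exp (-ε * s)

theorem Real.exp_neg_mul_isBigO {a b : ℝ} (h : a ≤ b) :
    (fun s : ℝ => Real.exp (-b * s)) =O[atTop] fun s => Real.exp (-a * s) := by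
  refine IsBigO.of_bound 1 ((eventually_ge_atTop 0).mono fun s hs => ?_)
  rw [Real.norm_eq_abs, Real.norm_eq_abs, Real.abs_exp, Real.abs_exp, one_mul]
  exact Real.exp_le_exp.2 (by nlinarith)

namespace ExpDecays

theorem zero {E : Type*} [SeminormedAddCommGroup E] : ExpDecays fun _ : ℝ => (0 : E) :=
  ⟨1, one_pos, isBigO_zero _ _⟩

theorem add {E : Type*} [SeminormedAddCommGroup E] {f g : ℝ → E} (hf : ExpDecays f)
    (hg : ExpDecays g) : ExpDecays fun s => f s + g s := by
  obtain ⟨a, ha, hf⟩ := hf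
  obtain ⟨b, hb, hg⟩ := hg
  exact ⟨min a b, lt_min ha hb, (hf.trans (Real.exp_neg_mul_isBigO (min_le_left _ _))).add
    (hg.trans (Real.exp_neg_mul_isBigO (min_le_right _ _)))⟩

theorem sum {ι E : Type*} [SeminormedAddCommGroup E] {f : ι → ℝ → E} (u : Finset ι)
    (hf : ∀ i ∈ u, ExpDecays (f i)) : ExpDecays fun s => ∑ i ∈ u, f i s := by
  classical
  induction u using Finset.induction_on with
  | empty => simpa using zero
  | insert i u hi ih =>
    simp only [Finset.sum_insert hi]
    exact (hf i (Finset.mem_insert_self i u)).add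
      (ih fun j hj => hf j (Finset.mem_insert_of_mem hj))

theorem const_mul {E : Type*} [SeminormedRing E] {f : ℝ → E} (hf : ExpDecays f) (c : E) :
    ExpDecays fun s => c * f s := by
  obtain ⟨a, ha, hf⟩ := hf
  exact ⟨a, ha, hf.const_mul_left c⟩

theorem mul {E : Type*} [SeminormedRing E] {f g : ℝ → E} (hf : ExpDecays f) (hg : ExpDecays g) :
    ExpDecays fun s => f s * g s := by
  obtain ⟨a, ha, hf⟩ := hf
  obtain ⟨b, hb, hg⟩ := hg
  refine ⟨a + b, add_pos ha hb, (hf.mul hg).congr_right fun s => ?_⟩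
  rw [← Real.exp_add]; ring_nf

theorem matrix_mul {l m n : Type*} [Fintype m] {F : ℝ → Matrix l m ℝ} {G : ℝ → Matrix m n ℝ}
    (hF : ∀ i j, ExpDecays fun s => F s i j) (hG : ∀ i j, ExpDecays fun s => G s i j) (i j) :
    ExpDecays fun s => (F s * G s) i j := by
  simp only [Matrix.mul_apply]
  exact sum _ fun k _ => (hF i k).mul (hG k j)

theorem matrix_mul_const {l m n : Type*} [Fintype m] {F : ℝ → Matrix l m ℝ}
    (hF : ∀ i j, ExpDecays fun s => F s i j) (K : Matrix m n ℝ) (i j) :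
    ExpDecays fun s => (F s * K) i j := by
  simp only [Matrix.mul_apply, mul_comm _ (K _ _)]
  exact sum _ fun k _ => (hF i k).const_mul (K k j)

theorem tendsto_zero {f : ℝ → ℝ} (hf : ExpDecays f) : Tendsto f atTop (𝓝 0) := by
  obtain ⟨a, ha, hf⟩ := hf
  refine hf.trans_tendsto (Real.tendsto_exp_atBot.comp ?_)
  exact tendsto_id.const_mul_atTop_of_neg (neg_neg_of_pos ha)

theorem integrableOn {f : ℝ → ℝ} (hf : ExpDecays f) (hc : Continuous f) :
    IntegrableOn f (Set.Ioi 0) := by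
  obtain ⟨a, ha, hf⟩ := hf
  exact integrable_of_isBigO_exp_neg ha hc.continuousOn hf

end ExpDecays

/-- The vectors `v` for which `exp(sA) v` decays exponentially. -/
def Matrix.expDecaySubmodule {n : Type*} [Fintype n] [DecidableEq n] (A : Matrix n n ℂ) :
    Submodule ℂ (n → ℂ) where
  carrier := {v | ∀ i, ExpDecays fun s : ℝ => (NormedSpace.exp ((s : ℂ) • A) *ᵥ v) i}
  zero_mem' := fun i => by simpa using ExpDecays.zero
  add_mem' := fun hv hw i => by
    simp only [Matrix.mulVec_add, Pi.add_apply]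
    exact (hv i).add (hw i)
  smul_mem' := fun c v hv i => by
    simp only [Matrix.mulVec_smul, Pi.smul_apply, smul_eq_mul]
    exact (hv i).const_mul c

/-- A generalized eigenvector for an eigenvalue `z` with `Re z < 0` decays under `exp(sA)`, like a
polynomial times `exp(s z)`; half of the rate absorbs the polynomial. -/
theorem Matrix.mem_expDecaySubmodule_of_pow_mulVec_eq_zero {n : Type*} [Fintype n] [DecidableEq n]
    (A : Matrix n n ℂ) {z : ℂ} (hz : z.re < 0) (v : n → ℂ) {k : ℕ}
    (hk : (A - z • (1 : Matrix n n ℂ)) ^ k *ᵥ v = 0) : v ∈ A.expDecaySubmodule := by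
  refine fun i => ⟨-z.re / 2, by linarith, ?_⟩
  simp only [Matrix.exp_smul_eq_exp_smul_sub A z, Matrix.smul_mulVec,
    Matrix.exp_smul_mulVec_of_pow_mulVec_eq_zero _ v hk, Pi.smul_apply, Finset.sum_apply,
    smul_eq_mul, Finset.mul_sum]
  refine IsBigO.fun_sum fun j _ => ?_
  have h1 : (fun s : ℝ => s ^ j) =O[atTop] fun s => Real.exp (-z.re / 2 * s) :=
    (isLittleO_pow_exp_pos_mul_atTop j (by linarith)).isBigO
  have h2 : (fun s : ℝ => Complex.exp (s * z) *
      ((s : ℂ) ^ j * (j.factorial : ℂ)⁻¹ * ((A - z • 1) ^ j *ᵥ v) i))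
      =O[atTop] fun s : ℝ => Real.exp (s * z.re) * s ^ j := by
    refine IsBigO.of_bound ‖(j.factorial : ℂ)⁻¹ * ((A - z • 1) ^ j *ᵥ v) i‖
      (Eventually.of_forall fun s => le_of_eq ?_)
    simp only [norm_mul, Complex.norm_exp, norm_pow, Complex.norm_real, Real.norm_eq_abs,
      Real.abs_exp]
    simp
    ring
  refine h2.trans (((isBigO_refl (fun s : ℝ => Real.exp (s * z.re)) atTop).mul h1).congr_right
    fun s => ?_)
  rw [← Real.exp_add]; ring_nf

/-- The generalized eigenspaces span, so every vector decays. -/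
theorem Matrix.expDecaySubmodule_eq_top {n : Type*} [Fintype n] [DecidableEq n]
    (A : Matrix n n ℂ) (hA : ∀ z ∈ spectrum ℂ A, z.re < 0) : A.expDecaySubmodule = ⊤ := by
  rw [eq_top_iff, ← Module.End.iSup_maxGenEigenspace_eq_top A.toLin', iSup_le_iff]
  intro z v hv
  obtain ⟨k, hk⟩ := Module.End.mem_maxGenEigenspace _ _ _ |>.1 hv
  by_cases hz : z ∈ spectrum ℂ A
  · refine A.mem_expDecaySubmodule_of_pow_mulVec_eq_zero (hA z hz) v (k := k) ?_
    rw [← Matrix.toLin'_apply, Matrix.toLin'_pow, map_sub, map_smul, Matrix.toLin'_one]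
    exact hk
  -- Outside the spectrum the generalized eigenspace is trivial.
  · have hu : IsUnit (A.toLin' - z • (1 : Module.End ℂ (n → ℂ))) := by
      rw [← Matrix.spectrum_toLin', spectrum.mem_iff, not_not, ← IsUnit.neg_iff, neg_sub] at hz
      exact hz
    have : v = 0 := by
      have := (Module.End.isUnit_iff _).1 (hu.pow k)
      exact this.1 (by rw [hk, map_zero])
    rw [this]; exact zero_mem _

open scoped Matrix.Norms.Operator in
/-- The entries of `exp(sA)` decay exponentially if the spectrum of `A` lies in the open left
half plane. -/
theorem IsAsymptoticallyStable.expDecays_exp {n : ℕ} {A : Matrix (Fin n) (Fin n) ℝ}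
    (hA : IsAsymptoticallyStable A) (i j : Fin n) :
    ExpDecays fun s : ℝ => NormedSpace.exp (s • A) i j := by
  have hm : (Pi.single j 1 : Fin n → ℂ) ∈ (A.map (algebraMap ℝ ℂ)).expDecaySubmodule := by
    rw [Matrix.expDecaySubmodule_eq_top _ hA]; trivial
  obtain ⟨ε, hε, h⟩ := hm i
  have hmap : ∀ s : ℝ, NormedSpace.exp ((s : ℂ) • A.map (algebraMap ℝ ℂ))
      = (NormedSpace.exp (s • A)).map (algebraMap ℝ ℂ) := fun s => by
    have := NormedSpace.map_exp ((algebraMap ℝ ℂ).mapMatrix : Matrix (Fin n) (Fin n) ℝ →+* _)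
      (Continuous.matrix_map continuous_id Complex.continuous_ofReal) (s • A)
    rw [RingHom.mapMatrix_apply, RingHom.mapMatrix_apply] at this
    refine Eq.trans ?_ this.symm
    congr 1
    ext a b
    simp
  refine ⟨ε, hε, IsBigO.of_norm_left (h.norm_left.congr_left fun s => ?_)⟩
  rw [hmap]
  simp

theorem IsAsymptoticallyStable.transpose {n : ℕ} {A : Matrix (Fin n) (Fin n) ℝ}
    (hA : IsAsymptoticallyStable A) : IsAsymptoticallyStable Aᵀ := by
  intro z hz
  refine hA z ?_
  rw [spectrum.mem_iff] at hz ⊢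
  rwa [← Matrix.isUnit_transpose, Matrix.transpose_sub, Matrix.algebraMap_eq_diagonal,
    Matrix.diagonal_transpose, ← Matrix.algebraMap_eq_diagonal, ← Matrix.transpose_map]

theorem expDecays_gramianIntegrand {n₁ n₂ : ℕ} {A₁ : Matrix (Fin n₁) (Fin n₁) ℝ}
    {A₂ : Matrix (Fin n₂) (Fin n₂) ℝ} (h₁ : IsAsymptoticallyStable A₁)
    (h₂ : IsAsymptoticallyStable A₂) (K : Matrix (Fin n₁) (Fin n₂) ℝ) (i j) :
    ExpDecays fun s => gramianIntegrand A₁ K A₂ s i j :=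
  ExpDecays.matrix_mul (ExpDecays.matrix_mul_const h₁.expDecays_exp K)
    h₂.transpose.expDecays_exp i j

theorem continuous_gramianIntegrand {n₁ n₂ : ℕ} (A₁ : Matrix (Fin n₁) (Fin n₁) ℝ)
    (K : Matrix (Fin n₁) (Fin n₂) ℝ) (A₂ : Matrix (Fin n₂) (Fin n₂) ℝ) (i j) :
    Continuous fun s => gramianIntegrand A₁ K A₂ s i j :=
  continuous_iff_continuousAt.2 fun t => (hasDerivAt_gramianIntegrand A₁ K A₂ t i j).continuousAt

theorem integrableOn_gramianIntegrand {n₁ n₂ : ℕ} {A₁ : Matrix (Fin n₁) (Fin n₁) ℝ}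
    {A₂ : Matrix (Fin n₂) (Fin n₂) ℝ} (h₁ : IsAsymptoticallyStable A₁)
    (h₂ : IsAsymptoticallyStable A₂) (K : Matrix (Fin n₁) (Fin n₂) ℝ) (i j) :
    IntegrableOn (fun s => gramianIntegrand A₁ K A₂ s i j) (Set.Ioi 0) :=
  (expDecays_gramianIntegrand h₁ h₂ K i j).integrableOn (continuous_gramianIntegrand A₁ K A₂ i j)

/-- The Sylvester equation `A₁ X + X A₂ᵀ = -K` solved by `X = ∫₀^∞ exp(A₁ s) K exp(A₂ᵀ s) ds`. -/
theorem gramianIntegral_sylvester {n₁ n₂ : ℕ} {A₁ : Matrix (Fin n₁) (Fin n₁) ℝ}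
    {A₂ : Matrix (Fin n₂) (Fin n₂) ℝ} (h₁ : IsAsymptoticallyStable A₁)
    (h₂ : IsAsymptoticallyStable A₂) (K : Matrix (Fin n₁) (Fin n₂) ℝ) :
    A₁ * gramianIntegral A₁ K A₂ + gramianIntegral A₁ K A₂ * A₂ᵀ = -K := by
  ext i j
  have hd := expDecays_gramianIntegrand h₁ h₂ K
  have hi := integrableOn_gramianIntegrand h₁ h₂ K
  have hint1 : ∀ k, IntegrableOn (fun s => A₁ i k * gramianIntegrand A₁ K A₂ s k j) (Set.Ioi 0) :=
    fun k => (hi k j).const_mul _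
  have hint2 : ∀ k, IntegrableOn (fun s => gramianIntegrand A₁ K A₂ s i k * A₂ᵀ k j) (Set.Ioi 0) :=
    fun k => (hi i k).mul_const _
  have hint : IntegrableOn (fun s => (A₁ * gramianIntegrand A₁ K A₂ s
      + gramianIntegrand A₁ K A₂ s * A₂ᵀ) i j) (Set.Ioi 0) := by
    simp only [Matrix.add_apply, Matrix.mul_apply]
    exact (integrable_finsetSum _ fun k _ => hint1 k).add
      (integrable_finsetSum _ fun k _ => hint2 k)
  have h := integral_Ioi_of_hasDerivAt_of_tendsto'
    (fun t _ => hasDerivAt_gramianIntegrand A₁ K A₂ t i j) hint (hd i j).tendsto_zero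
  have h0 : gramianIntegrand A₁ K A₂ 0 = K := by simp [gramianIntegrand]
  rw [h0, zero_sub] at h
  rw [Matrix.neg_apply, ← h]
  simp only [Matrix.add_apply, Matrix.mul_apply, gramianIntegral, Matrix.of_apply]
  rw [integral_add (integrable_finsetSum _ fun k _ => hint1 k)
    (integrable_finsetSum _ fun k _ => hint2 k),
    integral_finsetSum _ fun k _ => hint1 k, integral_finsetSum _ fun k _ => hint2 k]
  simp only [integral_const_mul, integral_mul_const]

end ExponentialDecay

section BalancedStability

open scoped ComplexOrder

/-! ### Stability of balanced subsystems -/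

/-- A nonzero subspace invariant under the square of a nonnegative diagonal matrix contains an
eigenvector of the diagonal matrix itself. -/
theorem Submodule.exists_eigenvector_diagonal {r : Type*} [Fintype r] [DecidableEq r]
    (E : Submodule ℂ (r → ℂ)) (d : r → ℝ) (hd : ∀ i, 0 ≤ d i) (hE : ∃ z ∈ E, z ≠ 0)
    (hinv : ∀ z ∈ E, (fun i => (d i : ℂ) * (d i * z i)) ∈ E) :
    ∃ z ∈ E, z ≠ 0 ∧ ∃ i, ∀ j, (d j : ℂ) * z j = d i * z j := by
  let D : Module.End ℂ (r → ℂ) :=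
    (Matrix.diagonal fun i => (d i : ℂ) * d i).toLin'
  have hD : ∀ z i, D z i = (d i : ℂ) * d i * z i := fun z i => by
    simp [D, Matrix.mulVec_diagonal]
  have hDE : ∀ z ∈ E, D z ∈ E := fun z hz => by
    have : D z = fun i => (d i : ℂ) * (d i * z i) := by
      ext i; rw [hD, mul_assoc]
    rw [this]; exact hinv z hz
  obtain ⟨z₀, hz₀, hne₀⟩ := hE
  have : Nontrivial E := ⟨⟨z₀, hz₀⟩, 0, fun h => hne₀ (congrArg Subtype.val h)⟩
  obtain ⟨c, hc⟩ := Module.End.exists_eigenvalue (D.restrict hDE)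
  obtain ⟨z, hz⟩ := hc.exists_hasEigenvector
  have hz1 : D z = c • (z : r → ℂ) := congrArg Subtype.val hz.apply_eq_smul
  have hz2 : (z : r → ℂ) ≠ 0 := fun h => hz.2 (Subtype.ext h)
  obtain ⟨i, hi⟩ := Function.ne_iff.1 hz2
  have hcomp : ∀ j, (d j : ℂ) * d j * (z : r → ℂ) j = c * (z : r → ℂ) j := fun j => by
    rw [← hD, hz1]; rfl
  have hci : c = (d i : ℂ) * d i := (mul_right_cancel₀ hi (hcomp i)).symm
  refine ⟨z, z.2, hz2, i, fun j => ?_⟩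
  by_cases hj : (z : r → ℂ) j = 0
  · simp [hj]
  · have h1 := mul_right_cancel₀ hj (hcomp j)
    rw [hci] at h1
    have h2 : d j * d j = d i * d i := by exact_mod_cast h1
    have h3 : d j = d i := by nlinarith [hd i, hd j, mul_self_eq_mul_self_iff.1 h2]
    rw [h3]

/-- The Lyapunov argument on the closed right half plane: an eigenvector `z` of `M` whose
eigenvalue is not in the open left half plane belongs to an imaginary eigenvalue, is annihilated
by the output matrix, and `S z` is an eigenvector of `Mᴴ`. -/
theorem Matrix.eigenvector_of_lyapunov {r p : Type*} [Fintype r] [DecidableEq r] [Fintype p]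
    {M S : Matrix r r ℂ} {C : Matrix p r ℂ} (hS : S.PosDef)
    (hL : Mᴴ * S + S * M = -(Cᴴ * C)) {z : r → ℂ} (hz : z ≠ 0) {c : ℂ} (hc : 0 ≤ c.re)
    (hMz : M *ᵥ z = c • z) :
    star c = -c ∧ C *ᵥ z = 0 ∧ Mᴴ *ᵥ (S *ᵥ z) = (-c) • (S *ᵥ z) := by
  have hpos : 0 < (star z ⬝ᵥ (S *ᵥ z)).re := (Complex.pos_iff.1 (hS.dotProduct_mulVec_pos hz)).1
  have him : (star z ⬝ᵥ (S *ᵥ z)).im = 0 :=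
    (Complex.pos_iff.1 (hS.dotProduct_mulVec_pos hz)).2.symm
  have hvec : Mᴴ *ᵥ (S *ᵥ z) + c • (S *ᵥ z) = -(Cᴴ *ᵥ (C *ᵥ z)) := by
    have := congrArg (fun X => X *ᵥ z) hL
    simp only [add_mulVec, ← mulVec_mulVec, neg_mulVec, hMz, mulVec_smul] at this
    exact this
  have hcc : 0 ≤ (star (C *ᵥ z) ⬝ᵥ (C *ᵥ z)) := dotProduct_star_self_nonneg _
  have hq : (star c + c) * (star z ⬝ᵥ (S *ᵥ z)) = -(star (C *ᵥ z) ⬝ᵥ (C *ᵥ z)) := by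
    have := congrArg (fun w => star z ⬝ᵥ w) hvec
    simp only [dotProduct_add, dotProduct_neg, dotProduct_smul, smul_eq_mul] at this
    have e1 : star z ⬝ᵥ (Mᴴ *ᵥ (S *ᵥ z)) = star c * (star z ⬝ᵥ (S *ᵥ z)) := by
      rw [dotProduct_mulVec, ← star_mulVec, hMz, star_smul, smul_dotProduct, smul_eq_mul]
    have e2 : star z ⬝ᵥ (Cᴴ *ᵥ (C *ᵥ z)) = star (C *ᵥ z) ⬝ᵥ (C *ᵥ z) := by
      rw [dotProduct_mulVec, ← star_mulVec]
    rw [e1, e2] at this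
    rw [← this]; ring
  have hre := congrArg Complex.re hq
  have hcr := (Complex.nonneg_iff.1 hcc).1
  simp only [Complex.mul_re, Complex.add_re, Complex.star_def, Complex.conj_re, him, mul_zero,
    sub_zero, Complex.neg_re] at hre
  have hc0 : c.re = 0 := by nlinarith
  have hstar : star c = -c := by
    apply Complex.ext <;> simp [hc0]
  have hCz : C *ᵥ z = 0 := by
    rw [← dotProduct_star_self_eq_zero]
    rw [hstar, neg_add_cancel, zero_mul] at hq
    exact neg_eq_zero.1 hq.symm
  refine ⟨hstar, hCz, ?_⟩
  rw [hCz, mulVec_zero, neg_zero] at hvec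
  rw [neg_smul]; exact eq_neg_of_add_eq_zero_left hvec

/-- If both a reachability and an observability Lyapunov equation with the same positive definite
`S` hold, the eigenspaces of `M` outside the open left half plane are invariant under `S²` and
annihilated by both factors of the right hand sides. -/
theorem Matrix.eigenvector_of_balanced_lyapunov {r p m : Type*} [Fintype r] [DecidableEq r]
    [Fintype p] [Fintype m] {M S : Matrix r r ℂ} {C : Matrix p r ℂ} {G : Matrix r m ℂ}
    (hS : S.PosDef) (hobs : Mᴴ * S + S * M = -(Cᴴ * C)) (hreach : M * S + S * Mᴴ = -(G * Gᴴ))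
    {z : r → ℂ} (hz : z ≠ 0) {c : ℂ} (hc : 0 ≤ c.re) (hMz : M *ᵥ z = c • z) :
    C *ᵥ z = 0 ∧ Gᴴ *ᵥ (S *ᵥ z) = 0 ∧ Mᴴ *ᵥ (S *ᵥ z) = (-c) • (S *ᵥ z) ∧
      M *ᵥ (S *ᵥ (S *ᵥ z)) = c • (S *ᵥ (S *ᵥ z)) := by
  obtain ⟨h1, h2, h3⟩ := eigenvector_of_lyapunov hS hobs hz hc hMz
  have hSz : S *ᵥ z ≠ 0 := fun h => hz (mulVec_injective_iff_isUnit.2 hS.isUnit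
    (by rw [h, mulVec_zero]))
  have hc' : 0 ≤ (-c).re := by rw [← h1]; simpa using hc
  obtain ⟨-, h5, h6⟩ := eigenvector_of_lyapunov (C := Gᴴ) (M := Mᴴ) hS
    (by simpa only [conjTranspose_conjTranspose] using hreach) hSz hc' h3
  refine ⟨h2, h5, h3, ?_⟩
  simpa only [conjTranspose_conjTranspose, neg_neg] using h6

theorem Matrix.conjTranspose_diagonal_ofReal {r : Type*} [DecidableEq r] (d : r → ℝ) :
    (diagonal fun i => (d i : ℂ))ᴴ = diagonal fun i => (d i : ℂ) := by
  rw [diagonal_conjTranspose]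
  congr 1
  ext i
  simp

/-- An orthogonal splitting of the coordinate space `n` into blocks `r` and `k`: the columns of
`J` and `K` together form an orthonormal basis. The relation `Kᴴ J = 0` follows from the others. -/
structure Matrix.IsBlockSplitting {n r k R : Type*} [Fintype n] [Fintype r] [Fintype k]
    [DecidableEq n] [DecidableEq r] [DecidableEq k] [CommRing R] [StarRing R]
    (J : Matrix n r R) (K : Matrix n k R) : Prop where
  left : Jᴴ * J = 1
  right : Kᴴ * K = 1
  left_right : Jᴴ * K = 0
  sum : J * Jᴴ + K * Kᴴ = 1

section Balanced

variable {n r k p m : Type*} [Fintype n] [Fintype r] [Fintype k] [DecidableEq n] [DecidableEq r]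
  [DecidableEq k] [Fintype p] [Fintype m] {J : Matrix n r ℂ} {K : Matrix n k ℂ}
  {A S : Matrix n n ℂ} {C : Matrix p n ℂ} {G : Matrix n m ℂ} {d₁ : r → ℝ} {d₂ : k → ℝ}

/-- In a balanced realisation whose two blocks of Hankel singular values are disjoint, the lower
right block `A₂₂ = Kᴴ A K` is nonsingular. -/
theorem Matrix.isUnit_block_of_balanced (hJK : IsBlockSplitting J K)
    (h₂ : ∀ i, 0 < d₂ i) (hd : ∀ i j, d₁ i ^ 2 ≠ d₂ j ^ 2)
    (hSJ : S * J = J * diagonal fun i => (d₁ i : ℂ))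
    (hSK : S * K = K * diagonal fun i => (d₂ i : ℂ)) (hSH : Sᴴ = S)
    (hobs : Aᴴ * S + S * A = -(Cᴴ * C)) (hreach : A * S + S * Aᴴ = -(G * Gᴴ))
    (hA : ∀ v, v ≠ 0 → A *ᵥ v ≠ 0) : IsUnit (Kᴴ * A * K) := by
  set D₁ : Matrix r r ℂ := diagonal fun i => (d₁ i : ℂ) with hD₁
  set D₂ : Matrix k k ℂ := diagonal fun i => (d₂ i : ℂ) with hD₂
  have hD₁H : D₁ᴴ = D₁ := conjTranspose_diagonal_ofReal d₁
  have hD₂H : D₂ᴴ = D₂ := conjTranspose_diagonal_ofReal d₂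
  have hJS : Jᴴ * S = D₁ * Jᴴ := by
    have := congrArg conjTranspose hSJ
    rwa [conjTranspose_mul, conjTranspose_mul, hSH, hD₁H] at this
  have hKS : Kᴴ * S = D₂ * Kᴴ := by
    have := congrArg conjTranspose hSK
    rwa [conjTranspose_mul, conjTranspose_mul, hSH, hD₂H] at this
  have hpos : D₂.PosDef := PosDef.diagonal fun i => by exact_mod_cast h₂ i
  have hobs' : (Kᴴ * A * K)ᴴ * D₂ + D₂ * (Kᴴ * A * K) = -((C * K)ᴴ * (C * K)) := by
    calc _ = Kᴴ * (Aᴴ * S + S * A) * K := by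
          simp only [conjTranspose_mul, conjTranspose_conjTranspose, Matrix.mul_add,
            Matrix.add_mul, Matrix.mul_assoc, hSK]
          simp only [← Matrix.mul_assoc, hKS]
      _ = _ := by simp only [hobs, conjTranspose_mul, Matrix.mul_assoc, Matrix.mul_neg,
          Matrix.neg_mul]
  have hreach' : (Kᴴ * A * K) * D₂ + D₂ * (Kᴴ * A * K)ᴴ = -((Kᴴ * G) * (Kᴴ * G)ᴴ) := by
    calc _ = Kᴴ * (A * S + S * Aᴴ) * K := by
          simp only [conjTranspose_mul, conjTranspose_conjTranspose, Matrix.mul_add,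
            Matrix.add_mul, Matrix.mul_assoc, hSK]
          simp only [← Matrix.mul_assoc, hKS]
      _ = _ := by simp only [hreach, conjTranspose_mul, Matrix.mul_assoc, Matrix.mul_neg,
          Matrix.neg_mul, conjTranspose_conjTranspose]
  rw [← mulVec_injective_iff_isUnit]
  by_contra hinj
  -- The kernel of the block is invariant under `D₂²`, so it contains an eigenvector of `D₂`.
  have hker : ∃ u ∈ LinearMap.ker (Kᴴ * A * K).mulVecLin, u ≠ 0 := by
    by_contra! h
    refine hinj ((injective_iff_map_eq_zero (Kᴴ * A * K).mulVecLin).2 fun a ha => h a ha)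
  have hDz : ∀ z : k → ℂ, D₂ *ᵥ (D₂ *ᵥ z) = fun i => (d₂ i : ℂ) * (d₂ i * z i) := fun z => by
    ext i; simp [hD₂, mulVec_diagonal]
  obtain ⟨u, hu, hu0, i, hui⟩ := Submodule.exists_eigenvector_diagonal
    (LinearMap.ker (Kᴴ * A * K).mulVecLin) d₂ (fun i => (h₂ i).le) hker (fun z hz => by
      by_cases hz0 : z = 0
      · have h0 : (fun i => (d₂ i : ℂ) * (d₂ i * z i)) = 0 := by ext i; simp [hz0]
        rw [h0]; exact zero_mem _
      · have := (eigenvector_of_balanced_lyapunov hpos hobs' hreach' hz0 (c := 0) le_rfl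
          (by rw [zero_smul]; exact hz)).2.2.2
        rw [zero_smul, hDz] at this
        exact this)
  have hu' : (Kᴴ * A * K) *ᵥ u = 0 := hu
  obtain ⟨hC, hG, -, -⟩ := eigenvector_of_balanced_lyapunov hpos hobs' hreach' hu0 (c := 0) le_rfl
    (by rw [zero_smul]; exact hu')
  have hD₂u : D₂ *ᵥ u = (d₂ i : ℂ) • u := by
    ext j; simp [hD₂, mulVec_diagonal, hui]
  have hdi : (d₂ i : ℂ) ≠ 0 := by exact_mod_cast (h₂ i).ne'
  set v := K *ᵥ u with hv
  have hSv : S *ᵥ v = (d₂ i : ℂ) • v := by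
    rw [hv, mulVec_mulVec, hSK, ← mulVec_mulVec, hD₂u, mulVec_smul]
  have hCv : C *ᵥ v = 0 := by rw [hv, mulVec_mulVec]; exact hC
  have hGv : Gᴴ *ᵥ v = 0 := by
    rw [hD₂u, mulVec_smul, smul_eq_zero_iff_right hdi, conjTranspose_mul,
      conjTranspose_conjTranspose, ← mulVec_mulVec] at hG
    exact hG
  -- Both right hand sides vanish at `v`, so `A v` is an eigenvector of `S²` for `d₂ i ^ 2`; its
  -- upper block is zero because that number is not in the upper block of `S²`.
  have e1 : (d₂ i : ℂ) • (Aᴴ *ᵥ v) = -(S *ᵥ (A *ᵥ v)) := by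
    have := congrArg (fun X => X *ᵥ v) hobs
    simp only [add_mulVec, ← mulVec_mulVec, neg_mulVec, hSv, hCv, mulVec_smul, mulVec_zero,
      neg_zero] at this
    exact eq_neg_of_add_eq_zero_left this
  have e2 : (d₂ i : ℂ) • (A *ᵥ v) = -(S *ᵥ (Aᴴ *ᵥ v)) := by
    have := congrArg (fun X => X *ᵥ v) hreach
    simp only [add_mulVec, ← mulVec_mulVec, neg_mulVec, hSv, hGv, mulVec_smul, mulVec_zero,
      neg_zero] at this
    exact eq_neg_of_add_eq_zero_left this
  have e3 : (d₂ i : ℂ) • ((d₂ i : ℂ) • (A *ᵥ v)) = S *ᵥ (S *ᵥ (A *ᵥ v)) := by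
    rw [e2, smul_neg, ← mulVec_smul, e1, mulVec_neg, neg_neg]
  have e4 : Jᴴ *ᵥ (A *ᵥ v) = 0 := by
    have h := congrArg (fun w => Jᴴ *ᵥ w) e3
    simp only [mulVec_smul] at h
    rw [mulVec_mulVec _ Jᴴ S, hJS, ← mulVec_mulVec, mulVec_mulVec _ Jᴴ S, hJS,
      ← mulVec_mulVec] at h
    ext j
    have hj := congrFun h j
    simp only [hD₁, mulVec_diagonal, Pi.smul_apply, smul_eq_mul] at hj
    have hne : ((d₂ i : ℂ) ^ 2 - (d₁ j : ℂ) ^ 2) ≠ 0 := by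
      rw [sub_ne_zero]; exact_mod_cast (hd j i).symm
    refine (mul_eq_zero.1 (?_ : ((d₂ i : ℂ) ^ 2 - (d₁ j : ℂ) ^ 2) * _ = 0)).resolve_left hne
    linear_combination hj
  have e5 : Kᴴ *ᵥ (A *ᵥ v) = 0 := by
    rw [hv, mulVec_mulVec, mulVec_mulVec]; exact hu'
  have hAv : A *ᵥ v = 0 := by
    rw [← one_mulVec (A *ᵥ v), ← hJK.sum, add_mulVec, ← mulVec_mulVec, ← mulVec_mulVec, e4, e5]
    simp
  refine hA v (fun h => hu0 ?_) hAv
  rw [← one_mulVec u, ← hJK.right, ← mulVec_mulVec, ← hv, h, mulVec_zero]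

/-- In a balanced realisation whose two blocks of Hankel singular values are disjoint, the singular
perturbation approximation is asymptotically stable. The reduced matrix `Ar` enters through the
factorisations `A V = J Ar` and `Wᴴ A = Ar Jᴴ`. -/
theorem Matrix.re_neg_of_balanced_spa (hJK : IsBlockSplitting J K)
    (h₁ : ∀ i, 0 < d₁ i) (hd : ∀ i j, d₁ i ^ 2 ≠ d₂ j ^ 2)
    (hSJ : S * J = J * diagonal fun i => (d₁ i : ℂ))
    (hSK : S * K = K * diagonal fun i => (d₂ i : ℂ)) (hSH : Sᴴ = S)
    (hobs : Aᴴ * S + S * A = -(Cᴴ * C)) (hreach : A * S + S * Aᴴ = -(G * Gᴴ))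
    (hA : ∀ (v : n → ℂ) (c : ℂ), v ≠ 0 → A *ᵥ v = c • v → c.re < 0)
    {V W : Matrix n r ℂ} {Ar : Matrix r r ℂ} (hV : A * V = J * Ar) (hW : Wᴴ * A = Ar * Jᴴ)
    (hJV : Jᴴ * V = 1) (hJW : Jᴴ * W = 1) {z₀ : r → ℂ} (hz₀ : z₀ ≠ 0) {c : ℂ}
    (hc : Ar *ᵥ z₀ = c • z₀) : c.re < 0 := by
  by_contra! hc0
  set D₁ : Matrix r r ℂ := diagonal fun i => (d₁ i : ℂ) with hD₁
  set D₂ : Matrix k k ℂ := diagonal fun i => (d₂ i : ℂ) with hD₂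
  have hD₁H : D₁ᴴ = D₁ := conjTranspose_diagonal_ofReal d₁
  have hD₂H : D₂ᴴ = D₂ := conjTranspose_diagonal_ofReal d₂
  have hJS : Jᴴ * S = D₁ * Jᴴ := by
    have := congrArg conjTranspose hSJ
    rwa [conjTranspose_mul, conjTranspose_mul, hSH, hD₁H] at this
  have hKS : Kᴴ * S = D₂ * Kᴴ := by
    have := congrArg conjTranspose hSK
    rwa [conjTranspose_mul, conjTranspose_mul, hSH, hD₂H] at this
  have hVA : Vᴴ * Aᴴ = Arᴴ * Jᴴ := by
    rw [← conjTranspose_mul, hV, conjTranspose_mul]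
  have hAW : Aᴴ * W = J * Arᴴ := by
    have := congrArg conjTranspose hW
    rwa [conjTranspose_mul, conjTranspose_mul, conjTranspose_conjTranspose,
      conjTranspose_conjTranspose] at this
  have hVJ : Vᴴ * J = 1 := by
    have := congrArg conjTranspose hJV
    rwa [conjTranspose_mul, conjTranspose_conjTranspose, conjTranspose_one] at this
  have hWJ : Wᴴ * J = 1 := by
    have := congrArg conjTranspose hJW
    rwa [conjTranspose_mul, conjTranspose_conjTranspose, conjTranspose_one] at this
  have hpos : D₁.PosDef := PosDef.diagonal fun i => by exact_mod_cast h₁ i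
  have hobs' : Arᴴ * D₁ + D₁ * Ar = -((C * V)ᴴ * (C * V)) := by
    have e1 : Vᴴ * (Aᴴ * S) * V = Arᴴ * D₁ := by
      rw [← Matrix.mul_assoc, hVA, Matrix.mul_assoc Arᴴ, hJS, Matrix.mul_assoc,
        Matrix.mul_assoc, hJV, Matrix.mul_one]
    have e2 : Vᴴ * (S * A) * V = D₁ * Ar := by
      rw [Matrix.mul_assoc, Matrix.mul_assoc, hV, ← Matrix.mul_assoc S, hSJ, Matrix.mul_assoc,
        ← Matrix.mul_assoc Vᴴ, hVJ, Matrix.one_mul]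
    rw [← e1, ← e2, ← Matrix.add_mul, ← Matrix.mul_add, hobs]
    simp only [conjTranspose_mul, Matrix.mul_assoc, Matrix.mul_neg, Matrix.neg_mul]
  have hreach' : Ar * D₁ + D₁ * Arᴴ = -((Wᴴ * G) * (Wᴴ * G)ᴴ) := by
    have e1 : Wᴴ * (A * S) * W = Ar * D₁ := by
      rw [← Matrix.mul_assoc, hW, Matrix.mul_assoc Ar, hJS, Matrix.mul_assoc,
        Matrix.mul_assoc, hJW, Matrix.mul_one]
    have e2 : Wᴴ * (S * Aᴴ) * W = D₁ * Arᴴ := by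
      rw [Matrix.mul_assoc, Matrix.mul_assoc, hAW, ← Matrix.mul_assoc S, hSJ, Matrix.mul_assoc,
        ← Matrix.mul_assoc Wᴴ, hWJ, Matrix.one_mul]
    rw [← e1, ← e2, ← Matrix.add_mul, ← Matrix.mul_add, hreach]
    simp only [conjTranspose_mul, Matrix.mul_assoc, Matrix.mul_neg, Matrix.neg_mul,
      conjTranspose_conjTranspose]
  have hDz : ∀ z : r → ℂ, D₁ *ᵥ (D₁ *ᵥ z) = fun i => (d₁ i : ℂ) * (d₁ i * z i) := fun z => by
    ext i; simp [hD₁, mulVec_diagonal]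
  obtain ⟨z, hz, hz0, i, hzi⟩ := Submodule.exists_eigenvector_diagonal
    (Module.End.eigenspace Ar.toLin' c) d₁ (fun i => (h₁ i).le)
    ⟨z₀, Module.End.mem_eigenspace_iff.2 (by simpa using hc), hz₀⟩ (fun z hz => by
      by_cases hz0 : z = 0
      · have h0 : (fun i => (d₁ i : ℂ) * (d₁ i * z i)) = 0 := by ext i; simp [hz0]
        rw [h0]; exact zero_mem _
      · rw [Module.End.mem_eigenspace_iff, toLin'_apply] at hz ⊢
        have := (eigenvector_of_balanced_lyapunov hpos hobs' hreach' hz0 hc0 hz).2.2.2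
        rwa [hDz] at this)
  rw [Module.End.mem_eigenspace_iff, toLin'_apply] at hz
  obtain ⟨hCz, hGz, hAz, -⟩ := eigenvector_of_balanced_lyapunov hpos hobs' hreach' hz0 hc0 hz
  have hD₁z : D₁ *ᵥ z = (d₁ i : ℂ) • z := by
    ext j; simp [hD₁, mulVec_diagonal, hzi]
  set s : ℂ := (d₁ i : ℂ) with hs
  set v := V *ᵥ z with hv
  set q := W *ᵥ (D₁ *ᵥ z) with hq
  -- With `v = V z` and `q = W D₁ z` the two Lyapunov equations give `S v = q` and `S q = s² v`.
  have hAv : A *ᵥ v = c • (J *ᵥ z) := by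
    rw [hv, mulVec_mulVec, hV, ← mulVec_mulVec, hz, mulVec_smul]
  have hSJz : S *ᵥ (J *ᵥ z) = s • (J *ᵥ z) := by
    rw [mulVec_mulVec, hSJ, ← mulVec_mulVec, hD₁z, mulVec_smul]
  have hAq : Aᴴ *ᵥ q = (-c * s) • (J *ᵥ z) := by
    rw [hq, mulVec_mulVec, hAW, ← mulVec_mulVec, hAz, hD₁z, smul_smul, mulVec_smul]
  have hAinj : Function.Injective A.mulVec := by
    refine (injective_iff_map_eq_zero A.mulVecLin).2 fun a ha => ?_
    by_contra h
    have := hA a 0 h (by rw [zero_smul]; exact ha)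
    simp at this
  have hAHinj : Function.Injective Aᴴ.mulVec := by
    rw [mulVec_injective_iff_isUnit] at hAinj ⊢
    exact (isUnit_conjTranspose A).2 hAinj
  have hSv : S *ᵥ v = q := by
    apply hAHinj
    have := congrArg (fun X => X *ᵥ v) hobs
    have hCv : C *ᵥ v = 0 := by rw [hv, mulVec_mulVec]; exact hCz
    simp only [add_mulVec, ← mulVec_mulVec, neg_mulVec, hCv, hAv, mulVec_smul, mulVec_zero,
      neg_zero, hSJz] at this
    rw [eq_neg_of_add_eq_zero_left this, hAq, smul_smul, ← neg_smul, neg_mul]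
  have hSq : S *ᵥ q = (s * s) • v := by
    apply hAinj
    have := congrArg (fun X => X *ᵥ q) hreach
    have hGq : Gᴴ *ᵥ q = 0 := by
      rw [hq, mulVec_mulVec]
      simpa only [conjTranspose_mul, conjTranspose_conjTranspose] using hGz
    simp only [add_mulVec, ← mulVec_mulVec, neg_mulVec, hGq, hAq, mulVec_smul, mulVec_zero,
      neg_zero, hSJz] at this
    rw [eq_neg_of_add_eq_zero_left this, mulVec_smul, hAv, smul_smul, smul_smul, ← neg_smul]
    congr 1; ring
  -- Hence `S² v = s² v`, and the lower block of `v` vanishes: `v = J z` is an eigenvector of `A`.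
  have hKv : Kᴴ *ᵥ v = 0 := by
    have h : Kᴴ *ᵥ (S *ᵥ (S *ᵥ v)) = (s * s) • (Kᴴ *ᵥ v) := by
      rw [hSv, hSq, mulVec_smul]
    rw [mulVec_mulVec _ Kᴴ S, hKS, ← mulVec_mulVec, mulVec_mulVec _ Kᴴ S, hKS,
      ← mulVec_mulVec] at h
    ext j
    have hj := congrFun h j
    simp only [hD₂, mulVec_diagonal, Pi.smul_apply, smul_eq_mul] at hj
    have hne : (s ^ 2 - (d₂ j : ℂ) ^ 2) ≠ 0 := by
      rw [sub_ne_zero, hs]; exact_mod_cast hd i j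
    refine (mul_eq_zero.1 (?_ : (s ^ 2 - (d₂ j : ℂ) ^ 2) * _ = 0)).resolve_left hne
    linear_combination -hj
  have hJv : Jᴴ *ᵥ v = z := by rw [hv, mulVec_mulVec, hJV, one_mulVec]
  have hvJ : v = J *ᵥ z := by
    rw [← one_mulVec v, ← hJK.sum, add_mulVec, ← mulVec_mulVec, ← mulVec_mulVec, hKv, hJv]
    simp
  have hv0 : v ≠ 0 := fun h => hz0 (by rw [← hJv, h, mulVec_zero])
  exact absurd (hA v c hv0 (by rw [hAv, hvJ])) (not_lt.2 hc0)

end Balanced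

end BalancedStability

/-! ### Hankel singular values and block decompositions -/

/-- The Hankel singular values decrease. An index out of range gives the value `0`, which is below
all others, so no bound on the indices is needed. -/
theorem hankelSV_antitone {n : ℕ} (P Q : Matrix (Fin n) (Fin n) ℝ) {i j : ℕ} (hij : i ≤ j) :
    hankelSV P Q (j + 1) ≤ hankelSV P Q (i + 1) := by
  unfold hankelSV
  simp only [Nat.add_sub_cancel]
  set s := (P * Q).charpoly.roots.map Real.sqrt with hs
  set l := s.sort (· ≥ ·) with hl
  have hnn : ∀ x ∈ l, 0 ≤ x := fun x hx => by
    rw [hl, Multiset.mem_sort, hs, Multiset.mem_map] at hx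
    obtain ⟨y, -, rfl⟩ := hx
    exact Real.sqrt_nonneg y
  have hsort : l.Pairwise (· ≥ ·) := Multiset.pairwise_sort _ _
  by_cases hj : j < l.length
  · have hi : i < l.length := lt_of_le_of_lt hij hj
    rw [List.getD_eq_getElem _ _ hj, List.getD_eq_getElem _ _ hi]
    rcases hij.eq_or_lt with h | h
    · subst h; exact le_rfl
    · exact List.pairwise_iff_getElem.1 hsort i j hi hj h
  · rw [List.getD_eq_default _ _ (not_lt.1 hj)]
    by_cases hi : i < l.length
    · rw [List.getD_eq_getElem _ _ hi]; exact hnn _ (List.getElem_mem hi)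
    · rw [List.getD_eq_default _ _ (not_lt.1 hi)]

/-- The inclusion of the first `r` coordinates into `ℝ^(r+k)`. -/
def Matrix.inclLeft (r k : ℕ) : Matrix (Fin (r + k)) (Fin r) ℝ :=
  (1 : Matrix (Fin (r + k)) (Fin (r + k)) ℝ).submatrix id (Fin.castAdd k)

/-- The inclusion of the last `k` coordinates into `ℝ^(r+k)`. -/
def Matrix.inclRight (r k : ℕ) : Matrix (Fin (r + k)) (Fin k) ℝ :=
  (1 : Matrix (Fin (r + k)) (Fin (r + k)) ℝ).submatrix id (Fin.natAdd r)

namespace Matrix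

section Incl

variable {r k : ℕ} {n : Type*}

theorem mul_inclLeft (M : Matrix n (Fin (r + k)) ℝ) :
    M * inclLeft r k = M.submatrix id (Fin.castAdd k) := by
  ext i j; simp [inclLeft, mul_apply, one_apply]

theorem mul_inclRight (M : Matrix n (Fin (r + k)) ℝ) :
    M * inclRight r k = M.submatrix id (Fin.natAdd r) := by
  ext i j; simp [inclRight, mul_apply, one_apply]

theorem inclLeft_transpose_mul (M : Matrix (Fin (r + k)) n ℝ) :
    (inclLeft r k)ᵀ * M = M.submatrix (Fin.castAdd k) id := by
  ext i j; simp [inclLeft, mul_apply, one_apply]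

theorem inclRight_transpose_mul (M : Matrix (Fin (r + k)) n ℝ) :
    (inclRight r k)ᵀ * M = M.submatrix (Fin.natAdd r) id := by
  ext i j; simp [inclRight, mul_apply, one_apply]

theorem isBlockSplitting_incl (r k : ℕ) : IsBlockSplitting (inclLeft r k) (inclRight r k) where
  left := by
    rw [conjTranspose_eq_transpose_of_trivial, inclLeft_transpose_mul]
    ext i j; simp [inclLeft, one_apply]
  right := by
    rw [conjTranspose_eq_transpose_of_trivial, inclRight_transpose_mul]
    ext i j; simp [inclRight, one_apply]
  left_right := by
    rw [conjTranspose_eq_transpose_of_trivial, inclLeft_transpose_mul]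
    ext i j; simp [inclRight, one_apply, Fin.ext_iff]; omega
  sum := by
    simp only [conjTranspose_eq_transpose_of_trivial]
    ext i j
    have h := congrFun (congrFun (Matrix.mul_one (1 : Matrix (Fin (r + k)) (Fin (r + k)) ℝ)ᵀ) j) i
    rw [mul_apply, Fin.sum_univ_add] at h
    rw [add_apply, mul_apply, mul_apply]
    simpa [inclLeft, inclRight, one_apply, eq_comm, mul_comm] using h

theorem diagonal_mul_inclLeft (d : Fin (r + k) → ℝ) :
    diagonal d * inclLeft r k = inclLeft r k * diagonal fun i => d (Fin.castAdd k i) := by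
  ext i j
  simp only [diagonal_mul, mul_diagonal, inclLeft, submatrix_apply, one_apply, id]
  split_ifs with h <;> simp [h]

theorem diagonal_mul_inclRight (d : Fin (r + k) → ℝ) :
    diagonal d * inclRight r k = inclRight r k * diagonal fun i => d (Fin.natAdd r i) := by
  ext i j
  simp only [diagonal_mul, mul_diagonal, inclRight, submatrix_apply, one_apply, id]
  split_ifs with h <;> simp [h]

end Incl

theorem conjTranspose_map_algebraMap {m n : Type*} (M : Matrix m n ℝ) :
    (M.map (algebraMap ℝ ℂ))ᴴ = Mᵀ.map (algebraMap ℝ ℂ) := by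
  ext i j; simp

theorem IsBlockSplitting.map_algebraMap {n r k : Type*} [Fintype n] [Fintype r] [Fintype k]
    [DecidableEq n] [DecidableEq r] [DecidableEq k] {J : Matrix n r ℝ} {K : Matrix n k ℝ}
    (h : IsBlockSplitting J K) :
    IsBlockSplitting (J.map (algebraMap ℝ ℂ)) (K.map (algebraMap ℝ ℂ)) := by
  have h1 := h.left
  have h2 := h.right
  have h3 := h.left_right
  have h5 := h.sum
  simp only [conjTranspose_eq_transpose_of_trivial] at h1 h2 h3 h5
  constructor <;> rw [conjTranspose_map_algebraMap]
  · rw [← Matrix.map_mul, h1]; simp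
  · rw [← Matrix.map_mul, h2]; simp
  · rw [← Matrix.map_mul, h3]; simp
  · rw [conjTranspose_map_algebraMap, ← Matrix.map_mul, ← Matrix.map_mul,
      ← Matrix.map_add _ (by simp), h5]
    simp

end Matrix

theorem IsAsymptoticallyStable.re_neg_of_mulVec {n : ℕ} {A : Matrix (Fin n) (Fin n) ℝ}
    (hA : IsAsymptoticallyStable A) {v : Fin n → ℂ} {c : ℂ} (hv : v ≠ 0)
    (h : A.map (algebraMap ℝ ℂ) *ᵥ v = c • v) : c.re < 0 := by
  refine hA c ?_
  rw [← Matrix.spectrum_toLin', ← Module.End.hasEigenvalue_iff_mem_spectrum]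
  exact Module.End.hasEigenvalue_of_hasEigenvector
    ⟨Module.End.mem_eigenspace_iff.2 (by simpa using h), hv⟩

theorem isAsymptoticallyStable_of_mulVec {n : ℕ} {A : Matrix (Fin n) (Fin n) ℝ}
    (h : ∀ (v : Fin n → ℂ) (c : ℂ), v ≠ 0 → A.map (algebraMap ℝ ℂ) *ᵥ v = c • v → c.re < 0) :
    IsAsymptoticallyStable A := by
  intro c hc
  rw [← Matrix.spectrum_toLin', ← Module.End.hasEigenvalue_iff_mem_spectrum] at hc
  obtain ⟨v, hv⟩ := hc.exists_hasEigenvector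
  exact h v c hv.2 (by simpa using hv.apply_eq_smul)

theorem IsAsymptoticallyStable.conj {n : ℕ} {A T : Matrix (Fin n) (Fin n) ℝ}
    (hA : IsAsymptoticallyStable A) (hT : IsUnit T.det) :
    IsAsymptoticallyStable (T * A * T⁻¹) := by
  refine isAsymptoticallyStable_of_mulVec fun v c hv h => ?_
  have h1 : T⁻¹ * T = 1 := Matrix.nonsing_inv_mul _ hT
  have h2 : T * T⁻¹ = 1 := Matrix.mul_nonsing_inv _ hT
  refine hA.re_neg_of_mulVec (v := T⁻¹.map (algebraMap ℝ ℂ) *ᵥ v) (fun h0 => hv ?_) ?_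
  · have := congrArg (fun w => T.map (algebraMap ℝ ℂ) *ᵥ w) h0
    simp only [Matrix.mulVec_mulVec, ← Matrix.map_mul, h2, Matrix.mulVec_zero] at this
    simpa using this
  · have := congrArg (fun w => T⁻¹.map (algebraMap ℝ ℂ) *ᵥ w) h
    simpa only [Matrix.mulVec_mulVec, ← Matrix.map_mul, Matrix.mulVec_smul, ← Matrix.mul_assoc,
      h1, Matrix.one_mul] using this

/-! ### The singular perturbation approximation of a balanced realisation -/

namespace LinSys

open Matrix

variable {r k m p : ℕ} (S : LinSys (r + k) m p)

theorem A₁₁_eq : S.A₁₁ = (inclLeft r k)ᵀ * S.A * inclLeft r k := by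
  rw [inclLeft_transpose_mul, mul_inclLeft]; rfl

theorem A₁₂_eq : S.A₁₂ = (inclLeft r k)ᵀ * S.A * inclRight r k := by
  rw [inclLeft_transpose_mul, mul_inclRight]; rfl

theorem A₂₁_eq : S.A₂₁ = (inclRight r k)ᵀ * S.A * inclLeft r k := by
  rw [inclRight_transpose_mul, mul_inclLeft]; rfl

theorem A₂₂_eq : S.A₂₂ = (inclRight r k)ᵀ * S.A * inclRight r k := by
  rw [inclRight_transpose_mul, mul_inclRight]; rfl

/-- The embedding `z ↦ (z, -A₂₂⁻¹ A₂₁ z)` of the slow states, for which `A V = J A_r`. -/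
noncomputable def spaLift : Matrix (Fin (r + k)) (Fin r) ℝ :=
  inclLeft r k - inclRight r k * (S.A₂₂⁻¹ * S.A₂₁)

/-- The transpose of `(I, -A₁₂ A₂₂⁻¹)`, for which `Wᵀ A = A_r Jᵀ`. -/
noncomputable def spaColift : Matrix (Fin (r + k)) (Fin r) ℝ :=
  inclLeft r k - inclRight r k * (S.A₁₂ * S.A₂₂⁻¹)ᵀ

theorem inclLeft_transpose_mul_spaLift : (inclLeft r k)ᵀ * S.spaLift = 1 := by
  have h := isBlockSplitting_incl r k
  rw [spaLift, Matrix.mul_sub, ← Matrix.mul_assoc, ← conjTranspose_eq_transpose_of_trivial,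
    h.left, h.left_right, Matrix.zero_mul, sub_zero]

theorem inclLeft_transpose_mul_spaColift : (inclLeft r k)ᵀ * S.spaColift = 1 := by
  have h := isBlockSplitting_incl r k
  rw [spaColift, Matrix.mul_sub, ← Matrix.mul_assoc, ← conjTranspose_eq_transpose_of_trivial,
    h.left, h.left_right, Matrix.zero_mul, sub_zero]

theorem A_mul_spaLift (h : IsUnit S.A₂₂.det) : S.A * S.spaLift = inclLeft r k * S.spa.A := by
  have hs := (isBlockSplitting_incl r k).sum
  simp only [conjTranspose_eq_transpose_of_trivial] at hs
  have e1 : (inclLeft r k)ᵀ * (S.A * S.spaLift) = S.spa.A := by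
    simp only [spaLift, spa, Matrix.mul_sub, A₁₁_eq, A₁₂_eq, Matrix.mul_assoc]
  have e2 : (inclRight r k)ᵀ * (S.A * S.spaLift) = 0 := by
    have : (inclRight r k)ᵀ * (S.A * S.spaLift) = S.A₂₁ - S.A₂₂ * S.A₂₂⁻¹ * S.A₂₁ := by
      have hX : ∀ X : Matrix (Fin k) (Fin r) ℝ,
          S.A₂₂ * X = (inclRight r k)ᵀ * (S.A * (inclRight r k * X)) := fun X => by
        rw [A₂₂_eq]; simp only [Matrix.mul_assoc]
      rw [Matrix.mul_assoc S.A₂₂, hX]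
      simp only [spaLift, Matrix.mul_sub, Matrix.mul_assoc, A₂₁_eq]
    rw [this, Matrix.mul_nonsing_inv _ h, Matrix.one_mul, sub_self]
  rw [← Matrix.one_mul (S.A * S.spaLift), ← hs, Matrix.add_mul, Matrix.mul_assoc,
    Matrix.mul_assoc, e1, e2, Matrix.mul_zero, add_zero]

theorem spaColift_transpose_mul_A (h : IsUnit S.A₂₂.det) :
    S.spaColiftᵀ * S.A = S.spa.A * (inclLeft r k)ᵀ := by
  have hs := (isBlockSplitting_incl r k).sum
  simp only [conjTranspose_eq_transpose_of_trivial] at hs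
  have e0 : S.spaColiftᵀ = (inclLeft r k)ᵀ - (S.A₁₂ * S.A₂₂⁻¹) * (inclRight r k)ᵀ := by
    rw [spaColift, transpose_sub, transpose_mul, transpose_transpose]
  have e1 : (S.spaColiftᵀ * S.A) * inclLeft r k = S.spa.A := by
    rw [e0, Matrix.sub_mul, Matrix.sub_mul, spa, A₁₁_eq]
    simp only [Matrix.mul_assoc]
    rw [← Matrix.mul_assoc (inclRight r k)ᵀ, ← A₂₁_eq]
  have e2 : (S.spaColiftᵀ * S.A) * inclRight r k = 0 := by
    rw [e0, Matrix.sub_mul, Matrix.sub_mul, ← A₁₂_eq]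
    rw [Matrix.mul_assoc, Matrix.mul_assoc, ← Matrix.mul_assoc (inclRight r k)ᵀ, ← A₂₂_eq,
      Matrix.mul_assoc, Matrix.nonsing_inv_mul _ h, Matrix.mul_one, sub_self]
  rw [← Matrix.mul_one (S.spaColiftᵀ * S.A), ← hs, Matrix.mul_add, ← Matrix.mul_assoc,
    ← Matrix.mul_assoc, e1, e2, Matrix.zero_mul, add_zero]

theorem spa_C_eq : S.spa.C = S.C * S.spaLift := by
  simp only [spaLift, spa, Matrix.mul_sub, mul_inclLeft, ← Matrix.mul_assoc, mul_inclRight]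
  rfl

theorem spa_B_eq : S.spa.B = (inclLeft r k)ᵀ * S.B := by
  rw [inclLeft_transpose_mul]; rfl

variable {S}

/-- Regularity of `A₂₂` and stability of the singular perturbation approximation of a balanced
realisation with separated Hankel singular values. -/
theorem isUnit_and_stable_of_balanced {d : Fin (r + k) → ℝ} (hd : ∀ i, 0 < d i)
    (hne : ∀ i j, d (Fin.castAdd k i) ≠ d (Fin.natAdd r j)) (hA : IsAsymptoticallyStable S.A)
    {q : Type*} [Fintype q] {G : Matrix (Fin (r + k)) q ℝ}
    (hreach : S.A * diagonal d + diagonal d * S.Aᵀ = -(G * Gᵀ))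
    (hobs : S.Aᵀ * diagonal d + diagonal d * S.A = -(S.Cᵀ * S.C)) :
    IsUnit S.A₂₂.det ∧ IsAsymptoticallyStable S.spa.A := by
  let φ := algebraMap ℝ ℂ
  have hJK := (isBlockSplitting_incl r k).map_algebraMap
  have hsq : ∀ i j, d (Fin.castAdd k i) ^ 2 ≠ d (Fin.natAdd r j) ^ 2 := fun i j h =>
    hne i j ((sq_eq_sq₀ (hd _).le (hd _).le).1 h)
  have hmap : ∀ {l : Type} [DecidableEq l] (f : l → ℝ),
      (diagonal f).map φ = diagonal fun i => (f i : ℂ) := fun f => by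
    rw [diagonal_map (map_zero _)]; rfl
  have hSJ : (diagonal d).map φ * (inclLeft r k).map φ =
      (inclLeft r k).map φ * diagonal fun i => (d (Fin.castAdd k i) : ℂ) := by
    rw [← hmap fun i => d (Fin.castAdd k i), ← Matrix.map_mul, ← Matrix.map_mul,
      diagonal_mul_inclLeft]
  have hSK : (diagonal d).map φ * (inclRight r k).map φ =
      (inclRight r k).map φ * diagonal fun i => (d (Fin.natAdd r i) : ℂ) := by
    rw [← hmap fun i => d (Fin.natAdd r i), ← Matrix.map_mul, ← Matrix.map_mul,
      diagonal_mul_inclRight]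
  have hSH : ((diagonal d).map φ)ᴴ = (diagonal d).map φ := by
    rw [conjTranspose_map_algebraMap, diagonal_transpose]
  have hneg : ∀ {a b : Type} (M : Matrix a b ℝ), (-M).map φ = -M.map φ := fun M => by
    ext i j; simp
  have hreach' : S.A.map φ * (diagonal d).map φ + (diagonal d).map φ * (S.A.map φ)ᴴ
      = -(G.map φ * (G.map φ)ᴴ) := by
    rw [conjTranspose_map_algebraMap, conjTranspose_map_algebraMap, ← Matrix.map_mul,
      ← Matrix.map_mul, ← Matrix.map_mul, ← Matrix.map_add _ (by simp), hreach, hneg]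
  have hobs' : (S.A.map φ)ᴴ * (diagonal d).map φ + (diagonal d).map φ * S.A.map φ
      = -((S.C.map φ)ᴴ * S.C.map φ) := by
    rw [conjTranspose_map_algebraMap, conjTranspose_map_algebraMap, ← Matrix.map_mul,
      ← Matrix.map_mul, ← Matrix.map_mul, ← Matrix.map_add _ (by simp), hobs, hneg]
  have hunit : IsUnit S.A₂₂.det := by
    have h := isUnit_block_of_balanced hJK (fun j => hd (Fin.natAdd r j)) hsq hSJ hSK hSH hobs'
      hreach' (fun v hv h0 => by
        have := hA.re_neg_of_mulVec (c := 0) hv (by rw [zero_smul]; exact h0)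
        simp at this)
    rw [conjTranspose_map_algebraMap, ← Matrix.map_mul, ← Matrix.map_mul, ← A₂₂_eq,
      isUnit_iff_isUnit_det, ← RingHom.mapMatrix_apply, ← RingHom.map_det] at h
    simpa using h
  refine ⟨hunit, isAsymptoticallyStable_of_mulVec fun z c hz hc => ?_⟩
  refine re_neg_of_balanced_spa hJK (V := S.spaLift.map φ) (W := S.spaColift.map φ)
    (fun j => hd (Fin.castAdd k j)) hsq hSJ hSK hSH hobs' hreach'
    (fun v c hv h => hA.re_neg_of_mulVec hv h) ?_ ?_ ?_ ?_ hz hc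
  · rw [← Matrix.map_mul, ← Matrix.map_mul, A_mul_spaLift S hunit]
  · rw [conjTranspose_map_algebraMap, conjTranspose_map_algebraMap, ← Matrix.map_mul,
      ← Matrix.map_mul, spaColift_transpose_mul_A S hunit]
  · rw [conjTranspose_map_algebraMap, ← Matrix.map_mul, inclLeft_transpose_mul_spaLift]
    simp
  · rw [conjTranspose_map_algebraMap, ← Matrix.map_mul, inclLeft_transpose_mul_spaColift]
    simp

/-- The squared `H₂` error of the singular perturbation approximation of a balanced realisation,
expressed through the truncated Hankel singular values and the mixed Gramian `G`. -/
theorem trace_error_eq {d : Fin (r + k) → ℝ} {R : Matrix (Fin m) (Fin m) ℝ}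
    (hunit : IsUnit S.A₂₂.det)
    (hreach : S.A * diagonal d + diagonal d * S.Aᵀ = -(S.B * R * S.Bᵀ))
    (hobs : S.Aᵀ * diagonal d + diagonal d * S.A = -(S.Cᵀ * S.C))
    {Pr : Matrix (Fin r) (Fin r) ℝ}
    (hPr : S.spa.A * Pr + Pr * S.spa.Aᵀ = -(S.spa.B * R * S.spa.Bᵀ))
    {G : Matrix (Fin (r + k)) (Fin r) ℝ}
    (hG : S.A * G + G * S.spa.Aᵀ = -(S.B * R * S.spa.Bᵀ)) :
    (S.C * diagonal d * S.Cᵀ).trace - 2 * (S.C * G * S.spa.Cᵀ).trace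
        + (S.spa.C * Pr * S.spa.Cᵀ).trace =
      ((diagonal fun j : Fin k => d (Fin.natAdd r j)) * (S.B₂ * R * S.B₂ᵀ
        - (2 : ℝ) • ((S.A₂₂ * G.submatrix (Fin.natAdd r) id
          + S.A₂₁ * G.submatrix (Fin.castAdd k) id) * (S.A₂₂⁻¹ * S.A₂₁)ᵀ))).trace := by
  set J := inclLeft r k with hJ
  set K := inclRight r k with hK
  set D := diagonal d with hD
  set D₁ := diagonal fun j : Fin r => d (Fin.castAdd k j) with hD₁
  set D₂ := diagonal fun j : Fin k => d (Fin.natAdd r j) with hD₂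
  set V := S.spaLift with hV
  set Ar := S.spa.A with hAr
  have hs : J * Jᵀ + K * Kᵀ = 1 := by
    simpa only [conjTranspose_eq_transpose_of_trivial] using (isBlockSplitting_incl r k).sum
  have hAV : S.A * V = J * Ar := A_mul_spaLift S hunit
  have hJV : Jᵀ * V = 1 := inclLeft_transpose_mul_spaLift S
  have hVJ : Vᵀ * J = 1 := by
    have := congrArg transpose hJV
    rwa [transpose_mul, transpose_transpose, transpose_one] at this
  have hDT : Dᵀ = D := diagonal_transpose d
  have hDJ : D * J = J * D₁ := diagonal_mul_inclLeft d
  have hDK : D * K = K * D₂ := diagonal_mul_inclRight d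
  have hJD : Jᵀ * D = D₁ * Jᵀ := by
    have := congrArg transpose hDJ
    rwa [transpose_mul, transpose_mul, hDT, hD₁, diagonal_transpose] at this
  have hKD : Kᵀ * D = D₂ * Kᵀ := by
    have := congrArg transpose hDK
    rwa [transpose_mul, transpose_mul, hDT, hD₂, diagonal_transpose] at this
  have hVA : Vᵀ * S.Aᵀ = Arᵀ * Jᵀ := by rw [← transpose_mul, hAV, transpose_mul]
  have hBr : S.spa.B = Jᵀ * S.B := spa_B_eq S
  have hB₂ : S.B₂ = Kᵀ * S.B := by rw [hK, inclRight_transpose_mul]; rfl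
  have hCr : S.spa.C = S.C * V := spa_C_eq S
  -- The observability equation restricted to the range of `V`.
  have hobs_r : Arᵀ * D₁ + D₁ * Ar = -(S.spa.Cᵀ * S.spa.C) := by
    have e1 : Vᵀ * (S.Aᵀ * D) * V = Arᵀ * D₁ := by
      rw [← Matrix.mul_assoc, hVA, Matrix.mul_assoc Arᵀ, hJD, Matrix.mul_assoc,
        Matrix.mul_assoc, hJV, Matrix.mul_one]
    have e2 : Vᵀ * (D * S.A) * V = D₁ * Ar := by
      rw [Matrix.mul_assoc, Matrix.mul_assoc, hAV, ← Matrix.mul_assoc D, hDJ, Matrix.mul_assoc,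
        ← Matrix.mul_assoc Vᵀ, hVJ, Matrix.one_mul]
    rw [← e1, ← e2, ← Matrix.add_mul, ← Matrix.mul_add, hobs, hCr]
    simp only [transpose_mul, Matrix.mul_assoc, Matrix.mul_neg, Matrix.neg_mul]
  -- Duality: an observability and a reachability equation give the same trace.
  have t1 : (S.C * D * S.Cᵀ).trace = (D * (S.B * R * S.Bᵀ)).trace := by
    have e1 : (S.C * D * S.Cᵀ).trace = -((S.Aᵀ * D + D * S.A) * D).trace := by
      rw [hobs, Matrix.neg_mul, trace_neg, neg_neg, trace_mul_comm, Matrix.mul_assoc,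
        ← Matrix.mul_assoc]
    have e2 : (D * (S.B * R * S.Bᵀ)).trace = -(D * (S.A * D + D * S.Aᵀ)).trace := by
      rw [hreach, Matrix.mul_neg, trace_neg, neg_neg]
    rw [e1, e2, Matrix.add_mul, Matrix.mul_add, trace_add, trace_add, add_comm]
    congr 2
    · rw [Matrix.mul_assoc]
    · rw [Matrix.mul_assoc, trace_mul_comm, Matrix.mul_assoc]
  have t2 : (S.spa.C * Pr * S.spa.Cᵀ).trace = (D₁ * (S.spa.B * R * S.spa.Bᵀ)).trace := by
    have e1 : (S.spa.C * Pr * S.spa.Cᵀ).trace = -((Arᵀ * D₁ + D₁ * Ar) * Pr).trace := by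
      rw [hobs_r, Matrix.neg_mul, trace_neg, neg_neg, trace_mul_comm, ← Matrix.mul_assoc]
    have e2 : (D₁ * (S.spa.B * R * S.spa.Bᵀ)).trace = -(D₁ * (Ar * Pr + Pr * Arᵀ)).trace := by
      rw [hPr, Matrix.mul_neg, trace_neg, neg_neg]
    rw [e1, e2, Matrix.add_mul, Matrix.mul_add, trace_add, trace_add, add_comm]
    congr 2
    · rw [Matrix.mul_assoc]
    · rw [Matrix.mul_assoc, trace_mul_comm, Matrix.mul_assoc]
  -- The mixed term: the observability equation meets the Sylvester equation of `G`.
  have t3 : (S.C * G * S.spa.Cᵀ).trace =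
      (D₁ * (S.spa.B * R * S.spa.Bᵀ)).trace + ((J - V)ᵀ * (D * (S.A * G))).trace := by
    have e1 : (S.C * G * S.spa.Cᵀ).trace = -(Vᵀ * (S.Aᵀ * D + D * S.A) * G).trace := by
      rw [hobs, hCr, transpose_mul, trace_mul_comm]
      simp only [Matrix.mul_neg, Matrix.neg_mul, trace_neg, neg_neg, Matrix.mul_assoc]
    have e2 : (Vᵀ * (S.Aᵀ * D) * G).trace = (Jᵀ * (D * (G * Arᵀ))).trace := by
      rw [← Matrix.mul_assoc, hVA, Matrix.mul_assoc, Matrix.mul_assoc, trace_mul_comm]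
      simp only [Matrix.mul_assoc]
    have e3 : G * Arᵀ = -(S.B * R * S.spa.Bᵀ) - S.A * G := by rw [← hG]; abel
    have e4 : (Jᵀ * (D * (S.B * R * S.spa.Bᵀ))) = D₁ * (S.spa.B * R * S.spa.Bᵀ) := by
      rw [← Matrix.mul_assoc, hJD, hBr]
      simp only [Matrix.mul_assoc]
    rw [e1, Matrix.mul_add, Matrix.add_mul, trace_add, e2, e3, Matrix.mul_sub, Matrix.mul_neg,
      Matrix.mul_sub, Matrix.mul_neg, e4, trace_sub, trace_neg, transpose_sub, Matrix.sub_mul,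
      trace_sub]
    simp only [Matrix.mul_assoc]
    ring
  -- Splitting a trace over the two blocks.
  have t4 : (D * (S.B * R * S.Bᵀ)).trace =
      (D₁ * (S.spa.B * R * S.spa.Bᵀ)).trace + (D₂ * (S.B₂ * R * S.B₂ᵀ)).trace := by
    have e1 : (D₁ * (S.spa.B * R * S.spa.Bᵀ)).trace
        = (J * Jᵀ * (D * (S.B * R * S.Bᵀ))).trace := by
      rw [hBr, transpose_mul, transpose_transpose, Matrix.mul_assoc J, trace_mul_comm J,
        ← Matrix.mul_assoc Jᵀ, hJD]
      simp only [Matrix.mul_assoc]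
    have e2 : (D₂ * (S.B₂ * R * S.B₂ᵀ)).trace
        = (K * Kᵀ * (D * (S.B * R * S.Bᵀ))).trace := by
      rw [hB₂, transpose_mul, transpose_transpose, Matrix.mul_assoc K, trace_mul_comm K,
        ← Matrix.mul_assoc Kᵀ, hKD]
      simp only [Matrix.mul_assoc]
    rw [e1, e2, ← trace_add, ← Matrix.add_mul, hs, Matrix.one_mul]
  have hJsub : J - V = K * (S.A₂₂⁻¹ * S.A₂₁) := by rw [hV, spaLift]; abel
  have hKAG : S.A₂₂ * G.submatrix (Fin.natAdd r) id + S.A₂₁ * G.submatrix (Fin.castAdd k) id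
      = Kᵀ * (S.A * G) := by
    rw [← inclRight_transpose_mul, ← inclLeft_transpose_mul, A₂₂_eq, A₂₁_eq, ← hJ, ← hK]
    conv_rhs => rw [← Matrix.one_mul G, ← hs]
    simp only [Matrix.add_mul, Matrix.mul_add, Matrix.mul_assoc]
    rw [add_comm]
  have t5 : ((J - V)ᵀ * (D * (S.A * G))).trace =
      (D₂ * ((Kᵀ * (S.A * G)) * (S.A₂₂⁻¹ * S.A₂₁)ᵀ)).trace := by
    rw [hJsub, transpose_mul, Matrix.mul_assoc, ← Matrix.mul_assoc Kᵀ, hKD, trace_mul_comm]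
    simp only [Matrix.mul_assoc]
  rw [hKAG, Matrix.mul_sub, trace_sub, Matrix.mul_smul, trace_smul, ← t5, t1, t2, t3, t4,
    smul_eq_mul]
  ring

end LinSys

/-! ### Second moments of Lévy processes -/

/-- A nonnegative additive function on `[0, ∞)` is linear. -/
theorem NNReal.eq_mul_of_additive_of_nonneg {f : ℝ≥0 → ℝ} (hadd : ∀ s t, f (s + t) = f s + f t)
    (hnn : ∀ t, 0 ≤ f t) (t : ℝ≥0) : f t = t * f 1 := by
  have hmono : Monotone f := fun s t hst => by
    have := hadd s (t - s)
    rw [add_tsub_cancel_of_le hst] at this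
    linarith [hnn (t - s)]
  have hnat : ∀ (n : ℕ) (s : ℝ≥0), f (n * s) = n * f s := fun n s => by
    induction n with
    | zero => have := hadd 0 0; simp only [add_zero] at this; simp; linarith
    | succ n ih => rw [Nat.cast_succ, add_mul, one_mul, hadd, ih]; push_cast; ring
  -- Comparing `n t` with its integer part bounds the defect by `f 1 / n`.
  have hbound : ∀ n : ℕ, n * |f t - t * f 1| ≤ f 1 := fun n => by
    have h1 : f (⌊(n : ℝ≥0) * t⌋₊ * 1) ≤ f (n * t) :=
      hmono (by rw [mul_one]; exact Nat.floor_le zero_le)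
    have h2 : f (n * t) ≤ f ((⌊(n : ℝ≥0) * t⌋₊ + 1 : ℕ) * 1) :=
      hmono (by rw [mul_one]; push_cast; exact (Nat.lt_floor_add_one _).le)
    have h3 : ((⌊(n : ℝ≥0) * t⌋₊ : ℕ) : ℝ) ≤ n * t := by
      exact_mod_cast Nat.floor_le (zero_le : 0 ≤ (n : ℝ≥0) * t)
    have h4 : (n : ℝ) * t ≤ (⌊(n : ℝ≥0) * t⌋₊ : ℕ) + 1 := by
      exact_mod_cast (Nat.lt_floor_add_one ((n : ℝ≥0) * t)).le
    rw [hnat, hnat] at h1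
    rw [hnat, hnat] at h2
    push_cast at h2
    have h5 := mul_le_mul_of_nonneg_right h3 (hnn 1)
    have h6 := mul_le_mul_of_nonneg_right h4 (hnn 1)
    rw [← abs_of_nonneg (Nat.cast_nonneg (α := ℝ) n), ← abs_mul, abs_le]
    constructor <;> nlinarith
  by_contra hne
  have hpos : 0 < |f t - t * f 1| := abs_pos.2 (sub_ne_zero.2 hne)
  obtain ⟨n, hn⟩ := exists_nat_gt (f 1 / |f t - t * f 1|)
  rw [div_lt_iff₀ hpos] at hn
  exact absurd (hbound n) (not_le.2 hn)

section DotProduct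

variable {Ω : Type*} [MeasurableSpace Ω] {μ : Measure Ω} {m : ℕ}

theorem measurable_dotProduct_left (v : Fin m → ℝ) : Measurable fun y : Fin m → ℝ => v ⬝ᵥ y :=
  (continuous_const.dotProduct continuous_id).measurable

theorem MeasureTheory.MemLp.dotProduct_left {f : Ω → Fin m → ℝ} (hf : MemLp f 2 μ) (v : Fin m → ℝ) :
    MemLp (fun ω => v ⬝ᵥ f ω) 2 μ := by
  simp only [dotProduct]
  exact memLp_finsetSum _ fun i _ => (memLp_pi_iff.1 hf i).const_mul (v i)

theorem integral_dotProduct_left [IsProbabilityMeasure μ] {f : Ω → Fin m → ℝ}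
    (hf : MemLp f 2 μ) (h0 : ∫ ω, f ω ∂μ = 0)
    (v : Fin m → ℝ) : ∫ ω, v ⬝ᵥ f ω ∂μ = 0 := by
  have hi : ∀ i, Integrable (fun ω => f ω i) μ := fun i =>
    (memLp_pi_iff.1 hf i).integrable one_le_two
  simp only [dotProduct]
  rw [integral_finsetSum _ fun i _ => (hi i).const_mul (v i)]
  refine Finset.sum_eq_zero fun i _ => ?_
  rw [integral_const_mul, ← eval_integral hi, h0, Pi.zero_apply, mul_zero]

theorem variance_dotProduct_left [IsProbabilityMeasure μ] {f : Ω → Fin m → ℝ}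
    (hf : MemLp f 2 μ) (h0 : ∫ ω, f ω ∂μ = 0)
    (v : Fin m → ℝ) : Var[fun ω => v ⬝ᵥ f ω; μ] = ∫ ω, (v ⬝ᵥ f ω) ^ 2 ∂μ :=
  variance_of_integral_eq_zero (hf.dotProduct_left v).aestronglyMeasurable.aemeasurable
    (integral_dotProduct_left hf h0 v)

end DotProduct

namespace IsLevyProcess

variable {Ω : Type*} [MeasurableSpace Ω] {μ : Measure Ω} {m : ℕ}
  {M : ℝ≥0 → Ω → (Fin m → ℝ)}

theorem variance_one [IsProbabilityMeasure μ] (hM_sq : ∀ t, MemLp (M t) 2 μ)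
    (hM_mean : ∀ t, ∫ ω, M t ω ∂μ = 0)
    (v : Fin m → ℝ) : Var[fun ω => v ⬝ᵥ M 1 ω; μ] = v ⬝ᵥ (covMatrix M μ *ᵥ v) := by
  rw [variance_dotProduct_left (hM_sq 1) (hM_mean 1)]
  have hL : ∀ i, MemLp (fun ω => M 1 ω i) 2 μ := fun i => memLp_pi_iff.1 (hM_sq 1) i
  have hij : ∀ i j, Integrable (fun ω => v i * v j * (M 1 ω i * M 1 ω j)) μ := fun i j =>
    ((hL i).integrable_mul (hL j)).const_mul _
  have h1 : ∀ ω, (v ⬝ᵥ M 1 ω) ^ 2 = ∑ i, ∑ j, v i * v j * (M 1 ω i * M 1 ω j) := fun ω => by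
    rw [sq, dotProduct, Finset.sum_mul_sum]
    exact Finset.sum_congr rfl fun i _ => Finset.sum_congr rfl fun j _ => by ring
  simp only [h1]
  rw [integral_finsetSum _ fun i _ => integrable_finsetSum _ fun j _ => hij i j]
  simp only [integral_finsetSum _ fun j _ => hij _ j, integral_const_mul]
  simp only [dotProduct, Matrix.mulVec, covMatrix, Matrix.of_apply, Finset.mul_sum]
  exact Finset.sum_congr rfl fun i _ => Finset.sum_congr rfl fun j _ => by ring

theorem variance_increment_eq (hM : IsLevyProcess M μ) (s h : ℝ≥0) (v : Fin m → ℝ) :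
    Var[fun ω => v ⬝ᵥ (M (s + h) ω - M s ω); μ] = Var[fun ω => v ⬝ᵥ M h ω; μ] :=
  ((hM.stationary_increments s h).comp (measurable_dotProduct_left v)).variance_eq

/-- The second moment grows linearly in time, since the increments are independent and
stationary. -/
theorem variance_dotProduct_eq [IsProbabilityMeasure μ] (hM : IsLevyProcess M μ)
    (hM_sq : ∀ t, MemLp (M t) 2 μ)
    (hM_mean : ∀ t, ∫ ω, M t ω ∂μ = 0) (t : ℝ≥0) (v : Fin m → ℝ) :
    Var[fun ω => v ⬝ᵥ M t ω; μ] = t * (v ⬝ᵥ (covMatrix M μ *ᵥ v)) := by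
  rw [← variance_one hM_sq hM_mean]
  refine NNReal.eq_mul_of_additive_of_nonneg (f := fun t => Var[fun ω => v ⬝ᵥ M t ω; μ])
    (fun s h => ?_) (fun t => variance_nonneg _ _) t
  have hdec : (fun ω => v ⬝ᵥ M (s + h) ω)
      = (fun ω => v ⬝ᵥ M s ω) + fun ω => v ⬝ᵥ (M (s + h) ω - M s ω) := by
    ext ω
    simp
  rw [← variance_increment_eq hM s h v, hdec]
  refine IndepFun.variance_add ((hM_sq s).dotProduct_left v)
    (((hM_sq (s + h)).sub (hM_sq s)).dotProduct_left v) ?_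
  exact (hM.indep_increments.indepFun_eval_sub zero_le le_self_add hM.start_zero).comp
      (measurable_dotProduct_left v) (measurable_dotProduct_left v)

/-- The Itô isometry for a deterministic step function. -/
theorem integral_sq_sum_increments [IsProbabilityMeasure μ] (hM : IsLevyProcess M μ)
    (hM_sq : ∀ t, MemLp (M t) 2 μ)
    (hM_mean : ∀ t, ∫ ω, M t ω ∂μ = 0) {t : ℕ → ℝ≥0} (ht : Monotone t) (w : ℕ → Fin m → ℝ)
    (N : ℕ) :
    ∫ ω, (∑ i ∈ Finset.range N, w i ⬝ᵥ (M (t (i + 1)) ω - M (t i) ω)) ^ 2 ∂μ =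
      ∑ i ∈ Finset.range N, ((t (i + 1) : ℝ) - t i) * (w i ⬝ᵥ (covMatrix M μ *ᵥ w i)) := by
  have hL : ∀ i, MemLp (fun ω => w i ⬝ᵥ (M (t (i + 1)) ω - M (t i) ω)) 2 μ := fun i =>
    MemLp.dotProduct_left ((hM_sq _).sub (hM_sq _)) (w i)
  have hmean : ∀ i, ∫ ω, w i ⬝ᵥ (M (t (i + 1)) ω - M (t i) ω) ∂μ = 0 := fun i =>
    integral_dotProduct_left ((hM_sq _).sub (hM_sq _)) (by
      simp only [Pi.sub_apply]
      rw [integral_sub ((hM_sq _).integrable one_le_two) ((hM_sq _).integrable one_le_two),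
        hM_mean, hM_mean, sub_zero]) (w i)
  have hind := hM.indep_increments.nat ht
  have hvar := IndepFun.variance_sum (μ := μ) (s := Finset.range N)
    (X := fun i ω => w i ⬝ᵥ (M (t (i + 1)) ω - M (t i) ω)) (fun i _ => hL i)
    (fun i _ j _ hij => (hind.indepFun hij).comp (measurable_dotProduct_left (w i))
      (measurable_dotProduct_left (w j)))
  have hsum : (∑ i ∈ Finset.range N, fun ω => w i ⬝ᵥ (M (t (i + 1)) ω - M (t i) ω))
      = fun ω => ∑ i ∈ Finset.range N, w i ⬝ᵥ (M (t (i + 1)) ω - M (t i) ω) := by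
    ext ω; simp
  rw [hsum, variance_of_integral_eq_zero
    (memLp_finsetSum _ fun i _ => hL i).aestronglyMeasurable.aemeasurable (by
      rw [integral_finsetSum _ fun i _ => (hL i).integrable one_le_two]
      exact Finset.sum_eq_zero fun i _ => hmean i)] at hvar
  rw [hvar]
  refine Finset.sum_congr rfl fun i _ => ?_
  have hti : t (i + 1) = t i + (t (i + 1) - t i) :=
    (add_tsub_cancel_of_le (ht (Nat.le_succ i))).symm
  have := variance_increment_eq hM (t i) (t (i + 1) - t i) (w i)
  rw [← hti, variance_dotProduct_eq hM hM_sq hM_mean,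
    NNReal.coe_sub (ht (Nat.le_succ i))] at this
  exact this

theorem covMatrix_posSemidef [IsProbabilityMeasure μ] (hM_sq : ∀ t, MemLp (M t) 2 μ)
    (hM_mean : ∀ t, ∫ ω, M t ω ∂μ = 0) : (covMatrix M μ).PosSemidef := by
  refine Matrix.PosSemidef.of_dotProduct_mulVec_nonneg ?_ fun v => ?_
  · ext i j
    simp [covMatrix, mul_comm]
  · rw [star_trivial, ← variance_one hM_sq hM_mean]
    exact variance_nonneg _ _

end IsLevyProcess

/-! ### Grids -/

/-- The smallest point of the grid `h ℕ` that is not below `s`. -/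
noncomputable def gridCeil (h s : ℝ) : ℝ := ⌈s / h⌉₊ * h

theorem le_gridCeil {h : ℝ} (hh : 0 < h) (s : ℝ) : s ≤ gridCeil h s :=
  (div_le_iff₀ hh).1 (Nat.le_ceil _)

theorem gridCeil_lt {h s : ℝ} (hh : 0 < h) (hs : 0 ≤ s) : gridCeil h s < s + h := by
  have := mul_lt_mul_of_pos_right (Nat.ceil_lt_add_one (div_nonneg hs hh.le)) hh
  rwa [add_mul, div_mul_cancel₀ _ hh.ne', one_mul] at this

theorem gridCeil_eq {h s : ℝ} {i : ℕ} (hs : s ∈ Set.Ioc (i * h) ((i + 1 : ℕ) * h)) :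
    gridCeil h s = (i + 1 : ℕ) * h := by
  have hh : 0 < h := by
    have := hs.1.trans_le hs.2
    push_cast at this
    linarith
  have : ⌈s / h⌉₊ = i + 1 := by
    rw [Nat.ceil_eq_iff (Nat.succ_ne_zero i)]
    exact ⟨by rw [lt_div_iff₀ hh]; exact_mod_cast hs.1, by rw [div_le_iff₀ hh]; exact hs.2⟩
  rw [gridCeil, this]

theorem measurable_gridCeil (h : ℝ) : Measurable (gridCeil h) :=
  ((measurable_from_top (f := fun n : ℕ => (n : ℝ))).comp
    (Nat.measurable_ceil.comp (measurable_id.div_const h))).mul_const h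

theorem measurable_comp_gridCeil {E : Type*} [MeasurableSpace E] (f : ℝ → E) (h : ℝ) :
    Measurable fun s => f (gridCeil h s) :=
  (measurable_from_top (f := fun n : ℕ => f (n * h))).comp
    (Nat.measurable_ceil.comp (measurable_id.div_const h))

theorem tendsto_gridCeil {h : ℕ → ℝ} (hh : ∀ N, 0 < h N) (h0 : Tendsto h atTop (𝓝 0)) {s : ℝ}
    (hs : 0 ≤ s) : Tendsto (fun N => gridCeil (h N) s) atTop (𝓝[≥] s) := by
  refine tendsto_nhdsWithin_iff.2 ⟨?_, Eventually.of_forall fun N => le_gridCeil (hh N) s⟩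
  refine tendsto_of_tendsto_of_tendsto_of_le_of_le tendsto_const_nhds
    (by simpa using tendsto_const_nhds.add h0 : Tendsto (fun N => s + h N) atTop (𝓝 s))
    (fun N => le_gridCeil (hh N) s) (fun N => (gridCeil_lt (hh N) hs).le)

theorem sum_intervalIntegral_grid {F : ℝ → ℝ} {G : ℕ → ℝ → ℝ} {h : ℝ} (hh : 0 ≤ h) (N : ℕ)
    (hF : IntervalIntegrable F volume 0 (N * h))
    (hG : ∀ i < N, ∀ s ∈ Set.Ioc (i * h) ((i + 1 : ℕ) * h), F s = G i s) :
    ∑ i ∈ Finset.range N, ∫ s in (i * h)..((i + 1 : ℕ) * h), G i s = ∫ s in 0..(N * h), F s := by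
  have hle : ∀ {i j : ℕ}, i ≤ j → (i : ℝ) * h ≤ j * h := fun hij =>
    mul_le_mul_of_nonneg_right (Nat.cast_le.2 hij) hh
  have h1 := intervalIntegral.sum_integral_adjacent_intervals (μ := volume) (f := F)
    (a := fun i : ℕ => (i : ℝ) * h) (n := N) (fun i hi => hF.mono_set (by
      rw [Set.uIcc_of_le (hle (Nat.le_succ i)),
        Set.uIcc_of_le (by simpa using hle (zero_le : 0 ≤ N))]
      exact Set.Icc_subset_Icc (by simpa using hle (zero_le : 0 ≤ i)) (hle hi)))
  simp only [Nat.cast_zero, zero_mul] at h1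
  rw [← h1]
  refine Finset.sum_congr rfl fun i hi => ?_
  rw [intervalIntegral.integral_of_le (hle (Nat.le_succ i)),
    intervalIntegral.integral_of_le (hle (Nat.le_succ i))]
  exact setIntegral_congr_fun measurableSet_Ioc fun s hs =>
    (hG i (Finset.mem_range.1 hi) s hs).symm

/-! ### Càdlàg paths -/

namespace IsCadlagPath

theorem continuousWithinAt_Ici {E : Type*} [TopologicalSpace E] {f : ℝ≥0 → E}
    (hf : IsCadlagPath f) (t : ℝ≥0) : ContinuousWithinAt f (Set.Ici t) t :=
  continuousWithinAt_Ioi_iff_Ici.1 (hf t).1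

theorem exists_norm_le {E : Type*} [SeminormedAddCommGroup E] {f : ℝ≥0 → E}
    (hf : IsCadlagPath f) (T : ℝ≥0) : ∃ K, ∀ s ≤ T, ‖f s‖ ≤ K := by
  have hloc : ∀ t, ∃ K, ∀ᶠ s in 𝓝 t, ‖f s‖ ≤ K := fun t => by
    obtain ⟨h1, l, h2⟩ := hf t
    have e1 : ∀ᶠ s in 𝓝[>] t, ‖f s‖ ≤ ‖f t‖ + 1 :=
      (h1.norm.eventually (gt_mem_nhds (lt_add_one _))).mono fun s hs => hs.le
    have e2 : ∀ᶠ s in 𝓝[<] t, ‖f s‖ ≤ ‖l‖ + 1 :=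
      (h2.norm.eventually (gt_mem_nhds (lt_add_one _))).mono fun s hs => hs.le
    refine ⟨max (‖f t‖ + 1) (‖l‖ + 1), ?_⟩
    have e3 : ∀ᶠ s in 𝓝[≠] t, ‖f s‖ ≤ max (‖f t‖ + 1) (‖l‖ + 1) := by
      rw [← Set.Iio_union_Ioi, nhdsWithin_union]
      exact eventually_sup.2 ⟨e2.mono fun s hs => hs.trans (le_max_right _ _),
        e1.mono fun s hs => hs.trans (le_max_left _ _)⟩
    rw [eventually_nhdsWithin_iff] at e3
    filter_upwards [e3] with s hs
    by_cases h : s = t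
    · subst h; exact (le_max_left _ _).trans' (by linarith)
    · exact hs h
  have hc := (isCompact_Icc (a := (0 : ℝ≥0)) (b := T)).induction_on
    (p := fun U => ∃ K, ∀ s ∈ U, ‖f s‖ ≤ K) ⟨0, by simp⟩
    (fun U U' hU ⟨K, hK⟩ => ⟨K, fun s hs => hK s (hU hs)⟩)
    (fun U U' ⟨K, hK⟩ ⟨K', hK'⟩ => ⟨max K K', fun s hs => hs.elim
      (fun h => (hK s h).trans (le_max_left _ _)) fun h => (hK' s h).trans (le_max_right _ _)⟩)
    (fun t _ => by
      obtain ⟨K, hK⟩ := hloc t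
      exact ⟨_, mem_nhdsWithin_of_mem_nhds hK, K, fun s hs => hs⟩)
  obtain ⟨K, hK⟩ := hc
  exact ⟨K, fun s hs => hK s ⟨zero_le, hs⟩⟩

theorem tendsto_comp_gridCeil {E : Type*} [TopologicalSpace E] {f : ℝ≥0 → E}
    (hf : IsCadlagPath f) {h : ℕ → ℝ} (hh : ∀ N, 0 < h N) (h0 : Tendsto h atTop (𝓝 0)) (s : ℝ) :
    Tendsto (fun N => f (gridCeil (h N) s).toNNReal) atTop (𝓝 (f s.toNNReal)) := by
  rcases le_total 0 s with hs | hs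
  · refine (hf.continuousWithinAt_Ici s.toNNReal).tendsto.comp ?_
    refine tendsto_nhdsWithin_iff.2 ⟨?_, Eventually.of_forall fun N =>
      Real.toNNReal_le_toNNReal (le_gridCeil (hh N) s)⟩
    exact (continuous_real_toNNReal.tendsto s).comp
      ((tendsto_gridCeil hh h0 hs).mono_right nhdsWithin_le_nhds)
  · have : ∀ N, gridCeil (h N) s = 0 := fun N => by
      rw [gridCeil, Nat.ceil_eq_zero.2 (div_nonpos_of_nonpos_of_nonneg hs (hh N).le)]; simp
    simp only [this, Real.toNNReal_zero, Real.toNNReal_of_nonpos hs]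
    exact tendsto_const_nhds

theorem measurable_comp_toNNReal {n : ℕ} {f : ℝ≥0 → Fin n → ℝ} (hf : IsCadlagPath f) :
    Measurable fun s : ℝ => f s.toNNReal :=
  measurable_of_tendsto_metrizable (fun N => measurable_comp_gridCeil (fun s => f s.toNNReal)
      (1 / ((N : ℝ) + 1)))
    (tendsto_pi_nhds.2 fun s => hf.tendsto_comp_gridCeil (fun _ => Nat.one_div_pos_of_nat)
      tendsto_one_div_add_atTop_nhds_zero_nat s)

end IsCadlagPath

/-! ### Variation of constants -/

theorem hasDerivAt_vecMul_exp {n : ℕ} (A : Matrix (Fin n) (Fin n) ℝ) (c : Fin n → ℝ) (t s : ℝ)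
    (j : Fin n) :
    HasDerivAt (fun s : ℝ => (c ᵥ* NormedSpace.exp ((t - s) • A)) j)
      (-((c ᵥ* NormedSpace.exp ((t - s) • A)) ᵥ* A) j) s := by
  have h1 : HasDerivAt (fun u : ℝ => (c ᵥ* NormedSpace.exp (u • A)) j)
      (((c ᵥ* NormedSpace.exp ((t - s) • A)) ᵥ* A) j) (t - s) := by
    rw [Matrix.vecMul_vecMul, ← Matrix.commute_exp_smul]
    simp only [Matrix.vecMul, dotProduct]
    exact HasDerivAt.fun_sum fun i _ =>
      (Matrix.hasDerivAt_exp_smul_apply A (t - s) i j).const_mul (c i)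
  exact h1.comp_const_sub t s

theorem continuous_vecMul_exp {n : ℕ} (A : Matrix (Fin n) (Fin n) ℝ) (c : Fin n → ℝ) (t : ℝ) :
    Continuous fun s : ℝ => c ᵥ* NormedSpace.exp ((t - s) • A) :=
  continuous_pi fun j => continuous_iff_continuousAt.2 fun s =>
    (hasDerivAt_vecMul_exp A c t s j).continuousAt

/-- Continuous functions are Riemann integrable: left endpoint sums on the uniform grid. -/
theorem tendsto_riemannSum {g : ℝ → ℝ} (hg : Continuous g) (t : ℝ≥0) :
    Tendsto (fun N : ℕ => ∑ i ∈ Finset.range (N + 1),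
        (t / ((N + 1 : ℕ) : ℝ)) * g (i * (t / ((N + 1 : ℕ) : ℝ))))
      atTop (𝓝 (∫ s in (0 : ℝ)..t, g s)) := by
  set h : ℕ → ℝ := fun N => t / ((N + 1 : ℕ) : ℝ) with hdef
  have hnn : ∀ N, 0 ≤ h N := fun N => by positivity
  have hNh : ∀ N, ((N + 1 : ℕ) : ℝ) * h N = t := fun N =>
    mul_div_cancel₀ _ (by positivity)
  have hle : ∀ N, h N ≤ t := fun N => div_le_self t.2 (by simp)
  have h0 : Tendsto h atTop (𝓝 0) :=
    (tendsto_const_nhds.div_atTop tendsto_natCast_atTop_atTop).comp (tendsto_add_atTop_nat 1)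
  obtain ⟨K, hK⟩ := (isCompact_Icc (a := -(t : ℝ)) (b := t + t)).exists_bound_of_continuousOn
    hg.continuousOn
  have hpos : ∀ {s}, s ∈ Set.Ioc (0 : ℝ) t → ∀ N, 0 < h N := fun hs N =>
    div_pos (hs.1.trans_le hs.2) (by positivity)
  have hmem : ∀ N, ∀ s ∈ Set.Ioc (0 : ℝ) t, gridCeil (h N) s - h N ∈ Set.Icc (-(t : ℝ)) (t + t) :=
    fun N s hs => ⟨by linarith [le_gridCeil (hpos hs N) s, hs.1, hle N],
      by linarith [gridCeil_lt (hpos hs N) hs.1.le, hs.2, hle N, t.coe_nonneg]⟩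
  have hmeas : ∀ N, Measurable fun s => g (gridCeil (h N) s - h N) := fun N =>
    hg.measurable.comp ((measurable_gridCeil _).sub_const _)
  have hint : ∀ N, IntervalIntegrable (fun s => g (gridCeil (h N) s - h N)) volume 0 t :=
    fun N => (intervalIntegrable_iff_integrableOn_Ioc_of_le t.coe_nonneg).2
      (Measure.integrableOn_of_bounded (M := K) (by simp) (hmeas N).aestronglyMeasurable
        (ae_restrict_of_forall_mem measurableSet_Ioc fun s hs => hK _ (hmem N s hs)))
  have hsum : ∀ N, ∑ i ∈ Finset.range (N + 1), h N * g (i * h N)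
      = ∫ s in (0 : ℝ)..t, g (gridCeil (h N) s - h N) := fun N => by
    have := sum_intervalIntegral_grid (F := fun s => g (gridCeil (h N) s - h N))
      (G := fun i _ => g (i * h N)) (hnn N) (N + 1) (by rw [hNh]; exact hint N)
      (fun i _ s hs => by
        rw [gridCeil_eq hs]; push_cast; ring_nf)
    rw [hNh] at this
    rw [← this]
    refine Finset.sum_congr rfl fun i _ => ?_
    rw [intervalIntegral.integral_const, smul_eq_mul]
    push_cast; ring
  simp only [hdef] at hsum ⊢
  simp only [hsum]
  refine intervalIntegral.tendsto_integral_filter_of_dominated_convergence (fun _ => K)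
    (Eventually.of_forall fun N => (hmeas N).aestronglyMeasurable)
    (Eventually.of_forall fun N => Eventually.of_forall fun s hs => ?_) (by simp)
    (Eventually.of_forall fun s hs => ?_)
  · rw [Set.uIoc_of_le t.coe_nonneg] at hs
    exact hK _ (hmem N s hs)
  · rw [Set.uIoc_of_le t.coe_nonneg] at hs
    have l1 : Tendsto (fun N => gridCeil (h N) s - h N) atTop (𝓝 s) := by
      simpa using ((tendsto_gridCeil (fun N => hpos hs N) h0 hs.1.le).mono_right
        nhdsWithin_le_nhds).sub h0
    exact (hg.tendsto s).comp l1

/-- Pathwise variation of constants: if `z(t) = ∫₀ᵗ A z ds + b(t)` and `b(0) = 0`, the Riemann–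
Stieltjes sums of `∫₀ᵗ c exp(A (t - s)) db(s)` converge to `c z(t)`. -/
theorem tendsto_variation_of_constants {n : ℕ} {A : Matrix (Fin n) (Fin n) ℝ}
    {z b : ℝ≥0 → Fin n → ℝ} (hz : IsCadlagPath z) (hb : b 0 = 0)
    (heq : ∀ t : ℝ≥0, z t = (∫ s in (0 : ℝ)..t, A *ᵥ z s.toNNReal) + b t) (c : Fin n → ℝ)
    (t : ℝ≥0) :
    Tendsto (fun N : ℕ => ∑ i ∈ Finset.range (N + 1),
        (c ᵥ* NormedSpace.exp (((t : ℝ) - i * (t / ((N + 1 : ℕ) : ℝ))) • A)) ⬝ᵥ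
          (b ((i + 1 : ℕ) * (t / ((N + 1 : ℕ) : ℝ≥0))) - b (i * (t / ((N + 1 : ℕ) : ℝ≥0)))))
      atTop (𝓝 (c ⬝ᵥ z t)) := by
  set h : ℕ → ℝ := fun N => t / ((N + 1 : ℕ) : ℝ) with hdef
  set g : ℝ → Fin n → ℝ := fun s => c ᵥ* NormedSpace.exp (((t : ℝ) - s) • A) with hg
  set ζ : ℝ → Fin n → ℝ := fun s => z s.toNNReal with hζ
  have hgc : Continuous g := continuous_vecMul_exp A c t
  have hζm : Measurable ζ := hz.measurable_comp_toNNReal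
  have hnn : ∀ N, 0 ≤ h N := fun N => by positivity
  have hNh : ∀ N, ((N + 1 : ℕ) : ℝ) * h N = t := fun N =>
    mul_div_cancel₀ _ (by positivity)
  have hle : ∀ N, h N ≤ t := fun N => div_le_self t.2 (by simp)
  have h0 : Tendsto h atTop (𝓝 0) :=
    (tendsto_const_nhds.div_atTop tendsto_natCast_atTop_atTop).comp (tendsto_add_atTop_nat 1)
  have hpos : ∀ {s}, s ∈ Set.Ioc (0 : ℝ) t → ∀ N, 0 < h N := fun hs N =>
    div_pos (hs.1.trans_le hs.2) (by positivity)
  -- Bounds for the integrands on `[0, t]` and the neighbouring grid cells.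
  obtain ⟨K₁, hK₁⟩ := (isCompact_Icc (a := -(t : ℝ)) (b := t + t)).exists_bound_of_continuousOn
    hgc.continuousOn
  obtain ⟨K₂, hK₂⟩ := hz.exists_norm_le (t + t)
  have hβc : Continuous fun q : (Fin n → ℝ) × (Fin n → ℝ) => q.1 ⬝ᵥ (A *ᵥ q.2) :=
    continuous_fst.dotProduct (continuous_const.matrix_mulVec continuous_snd)
  obtain ⟨K, hK⟩ := ((isCompact_closedBall (0 : Fin n → ℝ) K₁).prod
    (isCompact_closedBall (0 : Fin n → ℝ) K₂)).exists_bound_of_continuousOn hβc.continuousOn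
  have hbound : ∀ {u s : ℝ}, u ∈ Set.Icc (-(t : ℝ)) (t + t) → s ≤ t + t →
      ‖g u ⬝ᵥ (A *ᵥ ζ s)‖ ≤ K := fun {u s} hu hs =>
    hK (g u, ζ s) ⟨by simpa using hK₁ u hu, by
      simpa using hK₂ s.toNNReal (Real.toNNReal_le_iff_le_coe.2 (by simpa using hs))⟩
  have hmem : ∀ N, ∀ s ∈ Set.Ioc (0 : ℝ) t, gridCeil (h N) s - h N ∈ Set.Icc (-(t : ℝ)) (t + t) :=
    fun N s hs => ⟨by linarith [le_gridCeil (hpos hs N) s, hs.1, hle N],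
      by linarith [gridCeil_lt (hpos hs N) hs.1.le, hs.2, hle N, t.coe_nonneg]⟩
  have hmem' : ∀ s ∈ Set.Ioc (0 : ℝ) t, s ∈ Set.Icc (-(t : ℝ)) (t + t) :=
    fun s hs => ⟨by linarith [hs.1, t.coe_nonneg], by linarith [hs.2, t.coe_nonneg]⟩
  set F : ℕ → ℝ → ℝ := fun N s =>
    g s ⬝ᵥ (A *ᵥ ζ (gridCeil (h N) s)) - g (gridCeil (h N) s - h N) ⬝ᵥ (A *ᵥ ζ s) with hF
  have hFm : ∀ N, Measurable (F N) := fun N =>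
    (hβc.measurable.comp (hgc.measurable.prodMk (measurable_comp_gridCeil ζ (h N)))).sub
      (hβc.measurable.comp ((hgc.measurable.comp
        ((measurable_gridCeil (h N)).sub_const _)).prodMk hζm))
  have hFb : ∀ N, ∀ s ∈ Set.Ioc (0 : ℝ) t, ‖F N s‖ ≤ K + K := fun N s hs =>
    (norm_sub_le _ _).trans (add_le_add
      (hbound (hmem' s hs) (by linarith [gridCeil_lt (hpos hs N) hs.1.le, hs.2, hle N]))
      (hbound (hmem N s hs) (by linarith [hs.2, t.coe_nonneg])))
  have hFi : ∀ N, IntervalIntegrable (F N) volume 0 t := fun N =>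
    (intervalIntegrable_iff_integrableOn_Ioc_of_le t.coe_nonneg).2
      (Measure.integrableOn_of_bounded (M := K + K) (by simp) (hFm N).aestronglyMeasurable
        (ae_restrict_of_forall_mem measurableSet_Ioc fun s hs => hFb N s hs))
  have hζi : ∀ a b : ℝ≥0, IntervalIntegrable (fun s => A *ᵥ ζ s) volume a b := fun a b => by
    obtain ⟨L, hL⟩ := hz.exists_norm_le (max a b)
    obtain ⟨L', hL'⟩ := (isCompact_closedBall (0 : Fin n → ℝ) L).exists_bound_of_continuousOn
      (f := fun y => A *ᵥ y) (continuous_const.matrix_mulVec continuous_id).continuousOn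
    refine (intervalIntegrable_iff).2 (Measure.integrableOn_of_bounded (M := L') (by simp)
      ((continuous_const.matrix_mulVec continuous_id).measurable.comp hζm).aestronglyMeasurable
      (ae_restrict_of_forall_mem measurableSet_uIoc fun s hs => hL' _ ?_))
    have : s ≤ max (a : ℝ) b := hs.2
    simpa using hL s.toNNReal (Real.toNNReal_le_iff_le_coe.2 (by simpa using this))
  -- Summation by parts.
  have hsum : ∀ N, ∑ i ∈ Finset.range (N + 1), g (i * h N) ⬝ᵥ
      (b ((i + 1 : ℕ) * (t / ((N + 1 : ℕ) : ℝ≥0))) - b (i * (t / ((N + 1 : ℕ) : ℝ≥0))))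
      = c ⬝ᵥ z t + ∫ s in (0 : ℝ)..t, F N s := fun N => by
    set p : ℕ → ℝ≥0 := fun i => i * (t / ((N + 1 : ℕ) : ℝ≥0)) with hp
    have hpc : ∀ i : ℕ, (p i : ℝ) = i * h N := fun i => by simp [hp, hdef]
    have hζp : ∀ i : ℕ, ζ (i * h N) = z (p i) := fun i => by
      rw [← hpc]; simp [hζ]
    have hpN : p (N + 1) = t := by
      apply NNReal.coe_injective; rw [hpc, hNh]
    have hb_eq : ∀ i : ℕ, b (p (i + 1)) - b (p i) =
        z (p (i + 1)) - z (p i) - ∫ s in (i * h N)..((i + 1 : ℕ) * h N), A *ᵥ ζ s := fun i => by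
      have hadj := intervalIntegral.integral_add_adjacent_intervals (μ := volume)
        (hζi 0 (p i)) (hζi (p i) (p (i + 1)))
      rw [heq (p (i + 1)), heq (p i), ← hpc, ← hpc, ← NNReal.coe_zero, ← hadj]
      simp only [hζ]
      abel
    have hdot : ∀ (v : Fin n → ℝ) (a b : ℝ≥0),
        v ⬝ᵥ (∫ s in (a : ℝ)..b, A *ᵥ ζ s) = ∫ s in (a : ℝ)..b, v ⬝ᵥ (A *ᵥ ζ s) := fun v a b => by
      let L : (Fin n → ℝ) →L[ℝ] ℝ := LinearMap.toContinuousLinearMap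
        (Fintype.linearCombination ℝ v)
      have hL : ∀ y, L y = v ⬝ᵥ y := fun y => by
        simp [L, Fintype.linearCombination_apply, dotProduct, mul_comm]
      have := L.intervalIntegral_comp_comm (hζi a b)
      simp only [hL] at this
      exact this.symm
    have hgd : ∀ (i : ℕ) (y : Fin n → ℝ), (g ((i + 1 : ℕ) * h N) - g (i * h N)) ⬝ᵥ y
        = - ∫ s in (i * h N)..((i + 1 : ℕ) * h N), g s ⬝ᵥ (A *ᵥ y) := fun i y => by
      have hd : ∀ s, HasDerivAt (fun s => g s ⬝ᵥ y) (-(g s ⬝ᵥ (A *ᵥ y))) s := fun s => by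
        rw [Matrix.dotProduct_mulVec, ← neg_dotProduct]
        simp only [dotProduct]
        exact HasDerivAt.fun_sum fun j _ => (hasDerivAt_vecMul_exp A c t s j).mul_const (y j)
      have hci : Continuous fun s => -(g s ⬝ᵥ (A *ᵥ y)) :=
        (hgc.dotProduct continuous_const).neg
      rw [sub_dotProduct, ← intervalIntegral.integral_neg]
      exact (intervalIntegral.integral_eq_sub_of_hasDerivAt (fun s _ => hd s)
        (hci.intervalIntegrable _ _)).symm
    have hterm : ∀ i : ℕ, g (i * h N) ⬝ᵥ (b (p (i + 1)) - b (p i)) =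
        (g ((i + 1 : ℕ) * h N) ⬝ᵥ z (p (i + 1)) - g (i * h N) ⬝ᵥ z (p i)) +
        ∫ s in (i * h N)..((i + 1 : ℕ) * h N),
          (g s ⬝ᵥ (A *ᵥ z (p (i + 1))) - g (i * h N) ⬝ᵥ (A *ᵥ ζ s)) := fun i => by
      have hi2 : IntervalIntegrable (fun s => g (i * h N) ⬝ᵥ (A *ᵥ ζ s)) volume
          (i * h N) ((i + 1 : ℕ) * h N) := by
        rw [← hpc, ← hpc]
        obtain ⟨L, hL⟩ := hz.exists_norm_le (p (i + 1))
        have hc1 : Continuous fun y => g (p i) ⬝ᵥ (A *ᵥ y) :=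
          continuous_const.dotProduct (continuous_const.matrix_mulVec continuous_id)
        obtain ⟨L', hL'⟩ := (isCompact_closedBall (0 : Fin n → ℝ) L).exists_bound_of_continuousOn
          hc1.continuousOn
        have hpp : (p i : ℝ) ≤ p (i + 1) := by
          rw [hpc, hpc]
          exact mul_le_mul_of_nonneg_right (by push_cast; linarith) (hnn N)
        refine (intervalIntegrable_iff_integrableOn_Ioc_of_le hpp).2
          (Measure.integrableOn_of_bounded (M := L') (by simp)
            (hc1.measurable.comp hζm).aestronglyMeasurable
            (ae_restrict_of_forall_mem measurableSet_Ioc fun s hs => hL' _ ?_))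
        simpa using hL s.toNNReal (Real.toNNReal_le_iff_le_coe.2 hs.2)
      have hi1 : IntervalIntegrable (fun s => g s ⬝ᵥ (A *ᵥ z (p (i + 1)))) volume
          (i * h N) ((i + 1 : ℕ) * h N) :=
        (hgc.dotProduct continuous_const).intervalIntegrable _ _
      rw [intervalIntegral.integral_sub hi1 hi2, hb_eq, dotProduct_sub, dotProduct_sub]
      have e1 := hgd i (z (p (i + 1)))
      rw [sub_dotProduct] at e1
      have e2 := hdot (g (i * h N)) (p i) (p (i + 1))
      rw [hpc, hpc] at e2
      rw [e2]
      linarith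
    change ∑ i ∈ Finset.range (N + 1), g (i * h N) ⬝ᵥ (b (p (i + 1)) - b (p i)) = _
    rw [Finset.sum_congr rfl fun i _ => hterm i, Finset.sum_add_distrib,
      Finset.sum_range_sub (fun i : ℕ => g (i * h N) ⬝ᵥ z (p i)), hpN, hNh]
    have hz0 : z (p 0) = 0 := by
      have : p 0 = 0 := by simp [hp]
      rw [this, heq 0, hb]; simp
    have hgt : g t = c := by simp [hg]
    rw [hz0, hgt, dotProduct_zero, sub_zero]
    congr 1
    have := sum_intervalIntegral_grid (F := F N)
      (G := fun i s => g s ⬝ᵥ (A *ᵥ z (p (i + 1))) - g (i * h N) ⬝ᵥ (A *ᵥ ζ s)) (hnn N) (N + 1)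
      (by rw [hNh]; exact hFi N) (fun i _ s hs => by
        simp only [hF]
        rw [gridCeil_eq hs, hζp]
        congr 3
        push_cast; ring)
    rw [hNh] at this
    exact this
  simp only [hdef, hg] at hsum ⊢
  simp only [hsum]
  have hlim : Tendsto (fun N => ∫ s in (0 : ℝ)..t, F N s) atTop
      (𝓝 (∫ _ in (0 : ℝ)..t, (0 : ℝ))) := by
    refine intervalIntegral.tendsto_integral_filter_of_dominated_convergence (fun _ => K + K)
      (Eventually.of_forall fun N => (hFm N).aestronglyMeasurable)
      (Eventually.of_forall fun N => Eventually.of_forall fun s hs => ?_) (by simp)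
      (Eventually.of_forall fun s hs => ?_)
    · rw [Set.uIoc_of_le t.coe_nonneg] at hs
      exact hFb N s hs
    · rw [Set.uIoc_of_le t.coe_nonneg] at hs
      have l1 : Tendsto (fun N => gridCeil (h N) s - h N) atTop (𝓝 s) := by
        simpa using ((tendsto_gridCeil (fun N => hpos hs N) h0 hs.1.le).mono_right
          nhdsWithin_le_nhds).sub h0
      have l2 : Tendsto (fun N => ζ (gridCeil (h N) s)) atTop (𝓝 (ζ s)) :=
        hz.tendsto_comp_gridCeil (fun N => hpos hs N) h0 s
      have l3 := (hβc.tendsto (g s, ζ s)).comp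
        ((tendsto_const_nhds (x := g s)).prodMk_nhds l2)
      have l4 := (hβc.tendsto (g s, ζ s)).comp
        (((hgc.tendsto s).comp l1).prodMk_nhds (tendsto_const_nhds (x := ζ s)))
      simpa using l3.sub l4
  simpa using hlim.const_add (c ⬝ᵥ z t)

/-- Fatou's lemma for second moments. -/
theorem memLp_two_and_integral_sq_le_of_tendsto {Ω : Type*} [MeasurableSpace Ω] {μ : Measure Ω}
    {Y : ℕ → Ω → ℝ} {Y' : Ω → ℝ} {L : ℝ} (hY : ∀ N, MemLp (Y N) 2 μ)
    (hlim : ∀ᵐ ω ∂μ, Tendsto (fun N => Y N ω) atTop (𝓝 (Y' ω)))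
    (hL : Tendsto (fun N => ∫ ω, Y N ω ^ 2 ∂μ) atTop (𝓝 L)) :
    MemLp Y' 2 μ ∧ ∫ ω, Y' ω ^ 2 ∂μ ≤ L := by
  have hm : AEStronglyMeasurable Y' μ :=
    aestronglyMeasurable_of_tendsto_ae atTop (fun N => (hY N).aestronglyMeasurable) hlim
  have hLnn : 0 ≤ L := ge_of_tendsto' hL fun N => integral_nonneg fun ω => sq_nonneg _
  have hfatou : ∫⁻ ω, ENNReal.ofReal (Y' ω ^ 2) ∂μ ≤ ENNReal.ofReal L := by
    calc ∫⁻ ω, ENNReal.ofReal (Y' ω ^ 2) ∂μ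
        = ∫⁻ ω, liminf (fun N => ENNReal.ofReal (Y N ω ^ 2)) atTop ∂μ := by
          refine lintegral_congr_ae (hlim.mono fun ω hω => ?_)
          exact (((ENNReal.continuous_ofReal.tendsto _).comp (hω.pow 2)).liminf_eq).symm
      _ ≤ liminf (fun N => ∫⁻ ω, ENNReal.ofReal (Y N ω ^ 2) ∂μ) atTop :=
          lintegral_liminf_le' fun N =>
            ((hY N).aestronglyMeasurable.aemeasurable.pow_const 2).ennreal_ofReal
      _ = ENNReal.ofReal L := by
          simp only [← fun N => ofReal_integral_eq_lintegral_ofReal (hY N).integrable_sq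
            (Eventually.of_forall fun ω => sq_nonneg (Y N ω))]
          exact ((ENNReal.continuous_ofReal.tendsto _).comp hL).liminf_eq
  have hint : Integrable (fun ω => Y' ω ^ 2) μ := by
    refine ⟨hm.pow 2, ?_⟩
    rw [hasFiniteIntegral_iff_ofReal (Eventually.of_forall fun ω => sq_nonneg (Y' ω))]
    exact hfatou.trans_lt ENNReal.ofReal_lt_top
  refine ⟨(memLp_two_iff_integrable_sq hm).2 hint, ?_⟩
  rw [← ENNReal.ofReal_le_ofReal_iff hLnn, ofReal_integral_eq_lintegral_ofReal hint
    (Eventually.of_forall fun ω => sq_nonneg (Y' ω))]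
  exact hfatou

/-! ### The output error of two systems driven by the same noise -/

theorem Matrix.PosSemidef.exists_eq_mul_transpose {m : ℕ} {R : Matrix (Fin m) (Fin m) ℝ}
    (hR : R.PosSemidef) : ∃ (q : ℕ) (G : Matrix (Fin m) (Fin q) ℝ), R = G * Gᵀ := by
  obtain ⟨q, v, hv⟩ := Matrix.posSemidef_iff_eq_sum_vecMulVec.1 hR
  refine ⟨q, (Matrix.of v)ᵀ, ?_⟩
  rw [hv]
  ext i j
  simp [Matrix.mul_apply, Matrix.vecMulVec, Matrix.sum_apply]

theorem Matrix.trace_mul_mul_transpose {n₁ n₂ p : Type*} [Fintype n₁] [Fintype n₂] [Fintype p]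
    (C₁ : Matrix p n₁ ℝ) (X : Matrix n₁ n₂ ℝ) (C₂ : Matrix p n₂ ℝ) :
    (C₁ * X * C₂ᵀ).trace = ∑ j, C₁ j ⬝ᵥ (X *ᵥ C₂ j) := by
  simp only [trace, diag_apply]
  refine Finset.sum_congr rfl fun j _ => ?_
  rw [Matrix.mul_assoc]
  simp only [mul_apply, dotProduct, mulVec, transpose_apply]

theorem integral_sub_two_mul_add {α : Type*} [MeasurableSpace α] {μ : Measure α} {f g h : α → ℝ}
    (hf : Integrable f μ) (hg : Integrable g μ) (hh : Integrable h μ) :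
    ∫ a, (f a - 2 * g a + h a) ∂μ = ∫ a, f a ∂μ - 2 * ∫ a, g a ∂μ + ∫ a, h a ∂μ := by
  have hg2 : Integrable (fun a => 2 * g a) μ := hg.const_mul 2
  have hfg : Integrable (fun a => f a - 2 * g a) μ := hf.sub hg2
  rw [integral_add hfg hh, integral_sub hf hg2, integral_const_mul]

section GramianForms

variable {n₁ n₂ m : ℕ} {A₁ : Matrix (Fin n₁) (Fin n₁) ℝ} {A₂ : Matrix (Fin n₂) (Fin n₂) ℝ}

/-- A bilinear form in the integrand of a Gramian pairs two impulse responses. -/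
theorem dotProduct_gramianIntegrand (A₁ : Matrix (Fin n₁) (Fin n₁) ℝ)
    (A₂ : Matrix (Fin n₂) (Fin n₂) ℝ) (B₁ : Matrix (Fin n₁) (Fin m) ℝ)
    (B₂ : Matrix (Fin n₂) (Fin m) ℝ) (R : Matrix (Fin m) (Fin m) ℝ) (c₁ : Fin n₁ → ℝ)
    (c₂ : Fin n₂ → ℝ) (s : ℝ) :
    c₁ ⬝ᵥ (gramianIntegrand A₁ (B₁ * R * B₂ᵀ) A₂ s *ᵥ c₂) =
      ((c₁ ᵥ* NormedSpace.exp (s • A₁)) ᵥ* B₁) ⬝ᵥ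
        (R *ᵥ ((c₂ ᵥ* NormedSpace.exp (s • A₂)) ᵥ* B₂)) := by
  have h : NormedSpace.exp (s • A₂ᵀ) = (NormedSpace.exp (s • A₂))ᵀ := by
    rw [← Matrix.exp_transpose, Matrix.transpose_smul]
  rw [gramianIntegrand, h, ← Matrix.mulVec_transpose, ← Matrix.mulVec_transpose,
    ← Matrix.mulVec_transpose, ← Matrix.mulVec_transpose]
  simp only [Matrix.dotProduct_mulVec, Matrix.mulVec_transpose, ← Matrix.mulVec_mulVec]

theorem dotProduct_mulVec_eq_sum (X : Matrix (Fin n₁) (Fin n₂) ℝ) (c₁ : Fin n₁ → ℝ)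
    (c₂ : Fin n₂ → ℝ) : c₁ ⬝ᵥ (X *ᵥ c₂) = ∑ i, ∑ j, c₁ i * c₂ j * X i j := by
  simp only [dotProduct, Matrix.mulVec, Finset.mul_sum]
  exact Finset.sum_congr rfl fun i _ => Finset.sum_congr rfl fun j _ => by ring

theorem integrableOn_dotProduct_gramianIntegrand (h₁ : IsAsymptoticallyStable A₁)
    (h₂ : IsAsymptoticallyStable A₂) (K : Matrix (Fin n₁) (Fin n₂) ℝ) (c₁ : Fin n₁ → ℝ)
    (c₂ : Fin n₂ → ℝ) :
    IntegrableOn (fun s => c₁ ⬝ᵥ (gramianIntegrand A₁ K A₂ s *ᵥ c₂)) (Set.Ioi 0) := by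
  simp only [dotProduct_mulVec_eq_sum]
  exact integrable_finsetSum _ fun i _ => integrable_finsetSum _ fun j _ =>
    (integrableOn_gramianIntegrand h₁ h₂ K i j).const_mul _

theorem integral_dotProduct_gramianIntegrand (h₁ : IsAsymptoticallyStable A₁)
    (h₂ : IsAsymptoticallyStable A₂) (K : Matrix (Fin n₁) (Fin n₂) ℝ) (c₁ : Fin n₁ → ℝ)
    (c₂ : Fin n₂ → ℝ) :
    ∫ s in Set.Ioi 0, c₁ ⬝ᵥ (gramianIntegrand A₁ K A₂ s *ᵥ c₂) =
      c₁ ⬝ᵥ (gramianIntegral A₁ K A₂ *ᵥ c₂) := by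
  have hi : ∀ i j, IntegrableOn (fun s => c₁ i * c₂ j * gramianIntegrand A₁ K A₂ s i j)
      (Set.Ioi 0) := fun i j => (integrableOn_gramianIntegrand h₁ h₂ K i j).const_mul _
  simp only [dotProduct_mulVec_eq_sum]
  rw [integral_finsetSum _ fun i _ => integrable_finsetSum _ fun j _ => hi i j]
  simp only [integral_finsetSum _ fun j _ => hi _ j, integral_const_mul, gramianIntegral,
    Matrix.of_apply]

end GramianForms

namespace LinSys

variable {n₁ n₂ m p₁ p₂ : ℕ}

/-- The impulse response `c₁ exp(A₁ s) B₁ - c₂ exp(A₂ s) B₂` of the difference of two systems,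
observed through the row vectors `c₁` and `c₂`. -/
noncomputable def impulseDiff (S₁ : LinSys n₁ m p₁) (S₂ : LinSys n₂ m p₂) (c₁ : Fin n₁ → ℝ)
    (c₂ : Fin n₂ → ℝ) (s : ℝ) : Fin m → ℝ :=
  (c₁ ᵥ* NormedSpace.exp (s • S₁.A)) ᵥ* S₁.B - (c₂ ᵥ* NormedSpace.exp (s • S₂.A)) ᵥ* S₂.B

theorem continuous_impulseDiff (S₁ : LinSys n₁ m p₁) (S₂ : LinSys n₂ m p₂) (c₁ : Fin n₁ → ℝ)
    (c₂ : Fin n₂ → ℝ) : Continuous (S₁.impulseDiff S₂ c₁ c₂) := by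
  have h : ∀ {n : ℕ} (A : Matrix (Fin n) (Fin n) ℝ) (B : Matrix (Fin n) (Fin m) ℝ)
      (c : Fin n → ℝ), Continuous fun s : ℝ => (c ᵥ* NormedSpace.exp (s • A)) ᵥ* B := by
    intro n A B c
    refine Continuous.matrix_vecMul ?_ continuous_const
    have := (continuous_vecMul_exp A c 0).comp continuous_neg
    simpa [Function.comp_def] using this
  exact (h _ _ _).sub (h _ _ _)

/-- The integrand of the squared `H₂` error in terms of the integrands of the three Gramians. -/
theorem dotProduct_impulseDiff (S₁ : LinSys n₁ m p₁) (S₂ : LinSys n₂ m p₂) (c₁ : Fin n₁ → ℝ)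
    (c₂ : Fin n₂ → ℝ) {R : Matrix (Fin m) (Fin m) ℝ} (hR : Rᵀ = R) (s : ℝ) :
    S₁.impulseDiff S₂ c₁ c₂ s ⬝ᵥ (R *ᵥ S₁.impulseDiff S₂ c₁ c₂ s) =
      c₁ ⬝ᵥ (gramianIntegrand S₁.A (S₁.B * R * S₁.Bᵀ) S₁.A s *ᵥ c₁)
      - 2 * (c₁ ⬝ᵥ (gramianIntegrand S₁.A (S₁.B * R * S₂.Bᵀ) S₂.A s *ᵥ c₂))
      + c₂ ⬝ᵥ (gramianIntegrand S₂.A (S₂.B * R * S₂.Bᵀ) S₂.A s *ᵥ c₂) := by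
  simp only [dotProduct_gramianIntegrand, impulseDiff]
  set u := (c₁ ᵥ* NormedSpace.exp (s • S₁.A)) ᵥ* S₁.B
  set v := (c₂ ᵥ* NormedSpace.exp (s • S₂.A)) ᵥ* S₂.B
  have hvu : v ⬝ᵥ (R *ᵥ u) = u ⬝ᵥ (R *ᵥ v) := by
    rw [Matrix.dotProduct_mulVec, dotProduct_comm, ← Matrix.mulVec_transpose, hR]
  rw [Matrix.mulVec_sub, sub_dotProduct, dotProduct_sub, dotProduct_sub, hvu]
  ring

variable {Ω : Type*} [MeasurableSpace Ω] {μ : Measure Ω} [IsProbabilityMeasure μ]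
  {M : ℝ≥0 → Ω → (Fin m → ℝ)} {S₁ : LinSys n₁ m p₁} {S₂ : LinSys n₂ m p₂}
  {x₁ : ℝ≥0 → Ω → (Fin n₁ → ℝ)} {x₂ : ℝ≥0 → Ω → (Fin n₂ → ℝ)}

/-- The second moment of the difference of scalar observations of two systems driven by the same
Lévy process, bounded as in the Itô isometry. -/
theorem memLp_and_integral_sq_le (hM : IsLevyProcess M μ) (hM_sq : ∀ t, MemLp (M t) 2 μ)
    (hM_mean : ∀ t, ∫ ω, M t ω ∂μ = 0) (h₁ : S₁.IsSolution μ M 0 x₁)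
    (h₂ : S₂.IsSolution μ M 0 x₂) (c₁ : Fin n₁ → ℝ) (c₂ : Fin n₂ → ℝ) (t : ℝ≥0) :
    MemLp (fun ω => c₁ ⬝ᵥ x₁ t ω - c₂ ⬝ᵥ x₂ t ω) 2 μ ∧
      ∫ ω, (c₁ ⬝ᵥ x₁ t ω - c₂ ⬝ᵥ x₂ t ω) ^ 2 ∂μ ≤
        ∫ s in (0 : ℝ)..t, S₁.impulseDiff S₂ c₁ c₂ s ⬝ᵥ
          (covMatrix M μ *ᵥ S₁.impulseDiff S₂ c₁ c₂ s) := by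
  set w := S₁.impulseDiff S₂ c₁ c₂ with hw
  set R := covMatrix M μ with hR
  -- Stochastic integrals of the impulse response, discretised on uniform grids of `[0, t]`.
  let pt : ℕ → ℕ → ℝ≥0 := fun N i => i * (t / ((N + 1 : ℕ) : ℝ≥0))
  have hpt : ∀ N i, (pt N i : ℝ) = i * (t / ((N + 1 : ℕ) : ℝ)) := fun N i => by simp [pt]
  have hmono : ∀ N, Monotone (pt N) := fun N i j hij =>
    mul_le_mul_of_nonneg_right (Nat.cast_le.2 hij) zero_le
  let Y : ℕ → Ω → ℝ := fun N ω => ∑ i ∈ Finset.range (N + 1),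
    w ((t : ℝ) - i * (t / ((N + 1 : ℕ) : ℝ))) ⬝ᵥ (M (pt N (i + 1)) ω - M (pt N i) ω)
  have hY : ∀ N, MemLp (Y N) 2 μ := fun N => memLp_finsetSum _ fun i _ =>
    ((hM_sq _).sub (hM_sq _)).dotProduct_left _
  have hlim : ∀ᵐ ω ∂μ, Tendsto (fun N => Y N ω) atTop
      (𝓝 (c₁ ⬝ᵥ x₁ t ω - c₂ ⬝ᵥ x₂ t ω)) := by
    filter_upwards [h₁.cadlag, h₁.equation, h₂.cadlag, h₂.equation] with ω a₁ b₁ a₂ b₂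
    have l₁ := tendsto_variation_of_constants a₁ (b := fun s => S₁.B *ᵥ (M s ω - M 0 ω))
      (by simp) (fun s => by rw [b₁ s, zero_add]) c₁ t
    have l₂ := tendsto_variation_of_constants a₂ (b := fun s => S₂.B *ᵥ (M s ω - M 0 ω))
      (by simp) (fun s => by rw [b₂ s, zero_add]) c₂ t
    refine (l₁.sub l₂).congr fun N => ?_
    rw [← Finset.sum_sub_distrib]
    refine Finset.sum_congr rfl fun i _ => ?_
    rw [← Matrix.mulVec_sub, ← Matrix.mulVec_sub, sub_sub_sub_cancel_right,
      Matrix.dotProduct_mulVec, Matrix.dotProduct_mulVec, ← sub_dotProduct]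
    rfl
  have hL : Tendsto (fun N => ∫ ω, Y N ω ^ 2 ∂μ) atTop
      (𝓝 (∫ s in (0 : ℝ)..t, w s ⬝ᵥ (R *ᵥ w s))) := by
    have hwc : Continuous w := continuous_impulseDiff S₁ S₂ c₁ c₂
    have hgc : Continuous fun s : ℝ => w (t - s) ⬝ᵥ (R *ᵥ w (t - s)) := by
      have : Continuous fun s : ℝ => w (t - s) := hwc.comp (continuous_const.sub continuous_id)
      exact this.dotProduct (continuous_const.matrix_mulVec this)
    have hs := tendsto_riemannSum hgc t
    rw [intervalIntegral.integral_comp_sub_left (fun s => w s ⬝ᵥ (R *ᵥ w s)) (t : ℝ), sub_self,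
      sub_zero] at hs
    refine hs.congr fun N => ?_
    rw [IsLevyProcess.integral_sq_sum_increments hM hM_sq hM_mean (hmono N)
      (fun i => w ((t : ℝ) - i * (t / ((N + 1 : ℕ) : ℝ)))) (N + 1)]
    refine Finset.sum_congr rfl fun i _ => ?_
    rw [hpt, hpt]
    congr 1
    push_cast; ring
  exact memLp_two_and_integral_sq_le_of_tendsto hY hlim hL

/-- The mean square distance of the outputs of two asymptotically stable systems driven by the
same Lévy process is at most the squared `H₂` norm of their difference, uniformly in time. -/
theorem integrable_and_integral_norm_le {p : ℕ} {S₁ : LinSys n₁ m p} {S₂ : LinSys n₂ m p}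
    (hM : IsLevyProcess M μ) (hM_sq : ∀ t, MemLp (M t) 2 μ)
    (hM_mean : ∀ t, ∫ ω, M t ω ∂μ = 0) (h₁ : S₁.IsSolution μ M 0 x₁)
    (h₂ : S₂.IsSolution μ M 0 x₂) (hA₁ : IsAsymptoticallyStable S₁.A)
    (hA₂ : IsAsymptoticallyStable S₂.A) {L : ℝ}
    (hL : (S₁.C * gramianIntegral S₁.A (S₁.B * covMatrix M μ * S₁.Bᵀ) S₁.A * S₁.Cᵀ).trace
      - 2 * (S₁.C * gramianIntegral S₁.A (S₁.B * covMatrix M μ * S₂.Bᵀ) S₂.A * S₂.Cᵀ).trace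
      + (S₂.C * gramianIntegral S₂.A (S₂.B * covMatrix M μ * S₂.Bᵀ) S₂.A * S₂.Cᵀ).trace = L) :
    0 ≤ L ∧ ∀ t, Integrable (fun ω => S₁.output x₁ t ω - S₂.output x₂ t ω) μ ∧
      ∫ ω, ‖S₁.output x₁ t ω - S₂.output x₂ t ω‖ ∂μ ≤ √L := by
  have hpsd := IsLevyProcess.covMatrix_posSemidef hM_sq hM_mean
  set R := covMatrix M μ with hRdef
  have hR : Rᵀ = R := by
    have := hpsd.isHermitian.eq
    rwa [Matrix.conjTranspose_eq_transpose_of_trivial] at this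
  set κ : Fin p → ℝ → ℝ := fun j s => S₁.impulseDiff S₂ (S₁.C j) (S₂.C j) s ⬝ᵥ
    (R *ᵥ S₁.impulseDiff S₂ (S₁.C j) (S₂.C j) s) with hκ
  have hκnn : ∀ j s, 0 ≤ κ j s := fun j s => by
    simpa using hpsd.dotProduct_mulVec_nonneg (S₁.impulseDiff S₂ (S₁.C j) (S₂.C j) s)
  have hκeq : ∀ j, κ j = fun s => _ := fun j => funext fun s =>
    dotProduct_impulseDiff S₁ S₂ (S₁.C j) (S₂.C j) hR s
  have i1 := fun j => integrableOn_dotProduct_gramianIntegrand hA₁ hA₁ (S₁.B * R * S₁.Bᵀ)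
    (S₁.C j) (S₁.C j)
  have i2 := fun j => integrableOn_dotProduct_gramianIntegrand hA₁ hA₂ (S₁.B * R * S₂.Bᵀ)
    (S₁.C j) (S₂.C j)
  have i3 := fun j => integrableOn_dotProduct_gramianIntegrand hA₂ hA₂ (S₂.B * R * S₂.Bᵀ)
    (S₂.C j) (S₂.C j)
  have hκi : ∀ j, IntegrableOn (κ j) (Set.Ioi 0) := fun j => by
    rw [hκeq]
    exact ((i1 j).sub ((i2 j).const_mul 2)).add (i3 j)
  have hκL : ∑ j, ∫ s in Set.Ioi 0, κ j s = L := by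
    rw [← hL, Matrix.trace_mul_mul_transpose, Matrix.trace_mul_mul_transpose,
      Matrix.trace_mul_mul_transpose, Finset.mul_sum, ← Finset.sum_sub_distrib,
      ← Finset.sum_add_distrib]
    refine Finset.sum_congr rfl fun j _ => ?_
    rw [hκeq]
    refine (integral_sub_two_mul_add (i1 j) (i2 j) (i3 j)).trans ?_
    rw [integral_dotProduct_gramianIntegrand hA₁ hA₁, integral_dotProduct_gramianIntegrand hA₁ hA₂,
      integral_dotProduct_gramianIntegrand hA₂ hA₂]
  refine ⟨hκL ▸ Finset.sum_nonneg fun j _ => setIntegral_nonneg measurableSet_Ioi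
    fun s _ => hκnn j s, fun t => ?_⟩
  set e : Fin p → Ω → ℝ := fun j ω => S₁.C j ⬝ᵥ x₁ t ω - S₂.C j ⬝ᵥ x₂ t ω with he
  have hrow := fun j => memLp_and_integral_sq_le hM hM_sq hM_mean h₁ h₂ (S₁.C j) (S₂.C j) t
  have herr : (fun ω => S₁.output x₁ t ω - S₂.output x₂ t ω)
      = fun ω => WithLp.toLp 2 fun j => e j ω := by
    ext ω j
    simp [output, he, Matrix.mulVec]
  have hmeas : AEStronglyMeasurable (fun ω => S₁.output x₁ t ω - S₂.output x₂ t ω) μ := by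
    rw [herr]
    exact ((PiLp.continuous_toLp 2 _).measurable.comp_aemeasurable (aemeasurable_pi_lambda _
      fun j => (hrow j).1.aestronglyMeasurable.aemeasurable)).aestronglyMeasurable
  have hnorm : ∀ ω, ‖S₁.output x₁ t ω - S₂.output x₂ t ω‖ ^ 2 = ∑ j, e j ω ^ 2 := fun ω => by
    rw [congrFun herr ω, EuclideanSpace.real_norm_sq_eq]
  have hsq : ∀ j, Integrable (fun ω => e j ω ^ 2) μ := fun j => (hrow j).1.integrable_sq
  have hmem : MemLp (fun ω => S₁.output x₁ t ω - S₂.output x₂ t ω) 2 μ := by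
    refine (memLp_two_iff_integrable_sq_norm hmeas).2 ?_
    simp only [hnorm]
    exact integrable_finsetSum _ fun j _ => hsq j
  refine ⟨hmem.integrable one_le_two, ?_⟩
  have hle : ∫ ω, ‖S₁.output x₁ t ω - S₂.output x₂ t ω‖ ^ 2 ∂μ ≤ L := by
    simp only [hnorm]
    rw [integral_finsetSum _ fun j _ => hsq j, ← hκL]
    refine Finset.sum_le_sum fun j _ => (hrow j).2.trans ?_
    rw [intervalIntegral.integral_of_le t.coe_nonneg]
    exact setIntegral_mono_set (hκi j) (Eventually.of_forall fun s => hκnn j s)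
      (Eventually.of_forall fun s hs => hs.1)
  -- Nonnegativity of the variance gives `E‖e‖ ≤ (E‖e‖²)^(1/2)`.
  have hvar := variance_nonneg (fun ω => ‖S₁.output x₁ t ω - S₂.output x₂ t ω‖) μ
  rw [variance_eq_sub hmem.norm] at hvar
  refine (le_abs_self _).trans (Real.abs_le_sqrt (le_trans ?_ hle))
  simpa using hvar

end LinSys

/-! ### The error bound -/

theorem theorem2p11 {Ω : Type*} [MeasurableSpace Ω] (μ : Measure Ω) [IsProbabilityMeasure μ]
    {r k m p : ℕ} (hr : 0 < r) (hk : 0 < k)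
    -- the noise: a square integrable Lévy process with mean zero
    (M : ℝ≥0 → Ω → (Fin m → ℝ)) (hM : IsLevyProcess M μ)
    (hM_sq : ∀ t, MemLp (M t) 2 μ) (hM_mean : ∀ t, ∫ ω, M t ω ∂μ = 0)
    -- the system, with `n = r + k` states
    (S : LinSys (r + k) m p) (hA : IsAsymptoticallyStable S.A)
    (P Q : Matrix (Fin (r + k)) (Fin (r + k)) ℝ)
    (hP : P = S.reachGramian (covMatrix M μ)) (hQ : Q = S.obsGramian)
    (hP_pos : P.PosDef) (hQ_pos : Q.PosDef)
    (hσ : hankelSV P Q r ≠ hankelSV P Q (r + 1))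
    -- a balancing transformation, and the partitioned balanced realisation
    (T : Matrix (Fin (r + k)) (Fin (r + k)) ℝ) (hT : IsBalancing P Q T)
    (S' : LinSys (r + k) m p) (hS' : S' = S.transform T)
    -- the states of the system and of the reduced system, both started at zero
    (x : ℝ≥0 → Ω → (Fin (r + k) → ℝ)) (hx : S.IsSolution μ M 0 x)
    (x_r : ℝ≥0 → Ω → (Fin r → ℝ)) (hx_r : S'.spa.IsSolution μ M 0 x_r)
    (τ : ℝ≥0) :
    let Q_M := covMatrix M μ
    let P_g := gramianIntegral S.A (S.B * Q_M * S'.spa.Bᵀ) S'.spa.A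
    let P_g1 := (T * P_g).submatrix (Fin.castAdd k) id
    let P_g2 := (T * P_g).submatrix (Fin.natAdd r) id
    let Sigma₂ := Matrix.diagonal fun j : Fin k => hankelSV P Q (r + j + 1)
    let bound_sq := (Sigma₂ * (S'.B₂ * Q_M * S'.B₂ᵀ
      - (2 : ℝ) • ((S'.A₂₂ * P_g2 + S'.A₂₁ * P_g1) * (S'.A₂₂⁻¹ * S'.A₂₁)ᵀ))).trace
    let err : ℝ≥0 → Ω → EuclideanSpace ℝ (Fin p) :=
      fun t ω => S.output x t ω - S'.spa.output x_r t ω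
    -- the expressions in the bound and the expectations are well defined
    IsUnit S'.A₂₂.det ∧
    (∀ i j, IntegrableOn
      (fun s => gramianIntegrand S.A (S.B * Q_M * S'.spa.Bᵀ) S'.spa.A s i j) (Set.Ioi 0)) ∧
    0 ≤ bound_sq ∧
    (∀ t, t ≤ τ → Integrable (err t) μ) ∧
    BddAbove (Set.range fun t : Set.Icc (0 : ℝ≥0) τ => ∫ ω, ‖err t ω‖ ∂μ) ∧
    -- the error bound
    ⨆ t : Set.Icc (0 : ℝ≥0) τ, ∫ ω, ‖err t ω‖ ∂μ ≤ √bound_sq := by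
  intro Q_M P_g P_g1 P_g2 Sigma₂ bound_sq err
  have hTi : T⁻¹ * T = 1 := Matrix.nonsing_inv_mul _ hT.isUnit_det
  have hTi' : T * T⁻¹ = 1 := Matrix.mul_nonsing_inv _ hT.isUnit_det
  have hTt : (T⁻¹)ᵀ * Tᵀ = 1 := by rw [← Matrix.transpose_mul, hTi', Matrix.transpose_one]
  have hTt' : Tᵀ * (T⁻¹)ᵀ = 1 := by rw [← Matrix.transpose_mul, hTi, Matrix.transpose_one]
  set d : Fin (r + k) → ℝ := fun i => hankelSV P Q (i + 1) with hd
  have hA' : IsAsymptoticallyStable S'.A := by rw [hS']; exact hA.conj hT.isUnit_det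
  -- The Hankel singular values are positive, and those kept differ from those truncated.
  have hdpos : ∀ i, 0 < d i := by
    have hTu : Function.Injective Tᵀ.mulVec := by
      rw [Matrix.mulVec_injective_iff_isUnit, Matrix.isUnit_transpose,
        Matrix.isUnit_iff_isUnit_det]
      exact hT.isUnit_det
    have := hP_pos.conjTranspose_mul_mul_same hTu
    rw [Matrix.conjTranspose_eq_transpose_of_trivial, Matrix.transpose_transpose, hT.reach] at this
    exact Matrix.posDef_diagonal_iff.1 this
  have hlt : hankelSV P Q (r + 1) < hankelSV P Q r := by
    obtain ⟨r', rfl⟩ := Nat.exists_eq_succ_of_ne_zero hr.ne'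
    exact lt_of_le_of_ne (hankelSV_antitone P Q (Nat.le_succ r')) hσ.symm
  have hne : ∀ i j, d (Fin.castAdd k i) ≠ d (Fin.natAdd r j) := fun i j => by
    have h1 : hankelSV P Q (r + j + 1) ≤ hankelSV P Q (r + 1) :=
      hankelSV_antitone P Q (Nat.le_add_right r j)
    have h2 : hankelSV P Q r ≤ hankelSV P Q (i + 1) := by
      obtain ⟨r', rfl⟩ := Nat.exists_eq_succ_of_ne_zero hr.ne'
      exact hankelSV_antitone P Q (Nat.lt_succ_iff.1 i.2)
    simp only [hd, Fin.val_castAdd, Fin.val_natAdd]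
    exact (h1.trans_lt (hlt.trans_le h2)).ne'
  -- The Lyapunov equations in balanced coordinates.
  have hreach : S'.A * Matrix.diagonal d + Matrix.diagonal d * S'.Aᵀ
      = -(S'.B * Q_M * S'.Bᵀ) := by
    have h := gramianIntegral_sylvester hA hA (S.B * Q_M * S.Bᵀ)
    change S.A * S.reachGramian Q_M + S.reachGramian Q_M * S.Aᵀ = _ at h
    rw [← hP] at h
    have h' := congrArg (fun X => T * X * Tᵀ) h
    rw [← hT.reach, hS']
    simp only [LinSys.transform, Matrix.transpose_mul, Matrix.mul_add, Matrix.add_mul,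
      Matrix.mul_neg, Matrix.neg_mul, Matrix.mul_assoc] at h' ⊢
    rw [← h', ← Matrix.mul_assoc T⁻¹ T, hTi, ← Matrix.mul_assoc Tᵀ (T⁻¹)ᵀ, hTt']
    simp only [Matrix.one_mul]
  have hobs : S'.Aᵀ * Matrix.diagonal d + Matrix.diagonal d * S'.A = -(S'.Cᵀ * S'.C) := by
    have h := gramianIntegral_sylvester hA.transpose hA.transpose (S.Cᵀ * S.C)
    change S.Aᵀ * S.obsGramian + S.obsGramian * S.Aᵀᵀ = _ at h
    rw [← hQ, Matrix.transpose_transpose] at h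
    have h' := congrArg (fun X => (T⁻¹)ᵀ * X * T⁻¹) h
    rw [← hT.obs, hS']
    simp only [LinSys.transform, Matrix.transpose_mul, Matrix.mul_add, Matrix.add_mul,
      Matrix.mul_neg, Matrix.neg_mul, Matrix.mul_assoc] at h' ⊢
    rw [← h', ← Matrix.mul_assoc T⁻¹ T, hTi, ← Matrix.mul_assoc Tᵀ (T⁻¹)ᵀ, hTt']
    simp only [Matrix.one_mul]
  obtain ⟨hunit, hAr⟩ : IsUnit S'.A₂₂.det ∧ IsAsymptoticallyStable S'.spa.A := by
    obtain ⟨q, G, hG⟩ :=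
      (IsLevyProcess.covMatrix_posSemidef hM_sq hM_mean).exists_eq_mul_transpose
    refine LinSys.isUnit_and_stable_of_balanced hdpos hne hA' (G := S'.B * G) ?_ hobs
    rw [hreach]
    simp only [Q_M, hG, Matrix.transpose_mul, Matrix.mul_assoc]
  have hGm : S'.A * (T * P_g) + (T * P_g) * S'.spa.Aᵀ = -(S'.B * Q_M * S'.spa.Bᵀ) := by
    have h := congrArg (fun X => T * X)
      (gramianIntegral_sylvester hA hAr (S.B * Q_M * S'.spa.Bᵀ))
    change T * (S.A * P_g + P_g * S'.spa.Aᵀ) = T * -(S.B * Q_M * S'.spa.Bᵀ) at h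
    have e1 : S'.A = T * S.A * T⁻¹ := by rw [hS']; rfl
    have e2 : S'.B = T * S.B := by rw [hS']; rfl
    rw [e1, e2]
    simp only [Matrix.mul_add, Matrix.mul_neg, Matrix.mul_assoc] at h ⊢
    rw [← h, ← Matrix.mul_assoc T⁻¹ T, hTi, Matrix.one_mul]
  have hbound := LinSys.trace_error_eq hunit hreach hobs
    (gramianIntegral_sylvester hAr hAr (S'.spa.B * Q_M * S'.spa.Bᵀ)) hGm
  have hC : S'.C = S.C * T⁻¹ := by rw [hS']; rfl
  have hCP : S'.C * Matrix.diagonal d * S'.Cᵀ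
      = S.C * gramianIntegral S.A (S.B * Q_M * S.Bᵀ) S.A * S.Cᵀ := by
    change _ = S.C * S.reachGramian Q_M * S.Cᵀ
    rw [← hP, ← hT.reach, hC]
    simp only [Matrix.transpose_mul, Matrix.mul_assoc]
    rw [← Matrix.mul_assoc T⁻¹ T, hTi, ← Matrix.mul_assoc Tᵀ (T⁻¹)ᵀ, hTt']
    simp only [Matrix.one_mul]
  have hCG : S'.C * (T * P_g) = S.C * P_g := by
    rw [hC, Matrix.mul_assoc, ← Matrix.mul_assoc T⁻¹ T, hTi, Matrix.one_mul]
  rw [hCP, hCG] at hbound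
  change _ = bound_sq at hbound
  obtain ⟨hnn, herr⟩ := LinSys.integrable_and_integral_norm_le hM hM_sq hM_mean hx hx_r hA hAr
    hbound
  have : Nonempty (Set.Icc (0 : ℝ≥0) τ) := ⟨⟨0, le_rfl, zero_le⟩⟩
  refine ⟨hunit, integrableOn_gramianIntegrand hA hAr _, hnn, fun t _ => (herr t).1,
    ⟨√bound_sq, ?_⟩, ciSup_le fun t => (herr t).2⟩
  rintro _ ⟨t, rfl⟩
  exact (herr t).2
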